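/- **Setting.** Let $0<\varepsilon<1<b$, $T>0$, $R>0$, $\Omega=(\varepsilon,b)\times(0,T)\subset\mathbb R^2$ with points $(x,t)$. Let $H^4(\Omega)$ be the real Sobolev space with scalar product $[u,v]=\sum_{i+j\le 4}\int_\Omega \partial_x^i\partial_t^j u\,\partial_x^i\partial_t^j v\,dx\,dt$; by embedding $H^4(\Omega)\subset C^2(\overline\Omega)$, so that boundary values are classical. Put $H^4_0(\Omega)=\{v\in H^4(\Omega): v(\varepsilon,t)=v_x(\varepsilon,t)=v_x(b,t)=0,\ t\in(0,T)\}$. For $g_0:\mathbb R\to\mathbb R$ let $B(R,g_0)$ be the set of all $q\in H^4(\Omega)$ with $\|q\|_{H^4(\Omega)}<R$, $q(\varepsilon,t)=g_0(t+\varepsilon)$, $q_x(\varepsilon,t)=2g_0'(t+\varepsilon)$, $q_x(b,t)=0$ for $t\in(0,T)$, and $\frac1{2b^{1/4}}\le q(x,0)\le\frac12$ for $x\in[\varepsilon,b]$; let $\overline{B(R,g_0)}$ be its closure in $H^4(\Omega)$. We always assume $B(R,g_0)\ne\varnothing$. Let $q^0(x,0)$ be the truncation of $q(x,0)$ to $[\frac1{2b^{1/4}},\frac12]$,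 that is $q^0(x,0)=\max\{\frac1{2b^{1/4}},\min\{\frac12,q(x,0)\}\}$. For $\alpha\in(0,1/2)$ and real $\lambda,\beta$ put $e^{2\lambda\varphi}=e^{-2\lambda(x+\alpha t)}$ and define functionals on $H^4(\Omega)$ successively for $n=0,1,\dots$ by $$J^{(n)}_{\lambda,\beta}(q)=\int_\Omega\big(A_n(q)+B_n\big)^2e^{2\lambda\varphi}\,dx\,dt+\beta\|q\|^2_{H^4(\Omega)},$$ where $A_0(q)=q_{xx}-2q_{xt}$, $B_0=0$ and, for $n\ge1$, $$A_n(q)=q_{xx}-\frac{q_{xt}}{2\,(q^0_{n-1,\min}(x,0))^2},\qquad B_n=\partial_tq_{n-1,\min}(x,t)\,\frac{\partial_xq_{n-1,\min}(x,0)}{2\,(q^0_{n-1,\min}(x,0))^3},$$ with $q_{k,\min}$ a minimizer of $J^{(k)}_{\lambda,\beta}$ on $\overline{B(R,g_0)}$ for $k<n$ (same $\alpha,\lambda,\beta$). In all that follows $n\ge 0$ is any integer for which minimizers $q_{0,\min},\dots,q_{n-1,\min}$ are given. **Theorem 6.1.** 1. Let $\alpha\in(0,1/2)$ and $\lambda,\beta\in\mathbb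 R$. For every $q\in\overline{B(R,g_0)}$ the functional $J^{(n)}_{\lambda,\beta}$ has at $q$ a Fréchet derivative $(J^{(n)}_{\lambda,\beta}(q))'\in H^4_0(\Omega)$, i.e. $J^{(n)}_{\lambda,\beta}(q+h)=J^{(n)}_{\lambda,\beta}(q)+[(J^{(n)}_{\lambda,\beta}(q))',h]+o(\|h\|_{H^4(\Omega)})$ as $h\to0$ in $H^4_0(\Omega)$, and for all $h\in H_0^4(\Omega)$ $$\big(J^{(n)}_{\lambda,\beta}(q)\big)'(h):=\big[\big(J^{(n)}_{\lambda,\beta}(q)\big)',h\big]=2\int_\Omega\big(A_n(q)+B_n\big)A_n(h)\,e^{2\lambda\varphi}\,dx\,dt+2\beta[q,h].$$ 2. Under the assumptions of 1 there is a constant $D>0$ such that $\|(J^{(n)}_{\lambda,\beta}(q_2))'-(J^{(n)}_{\lambda,\beta}(q_1))'\|_{H^4(\Omega)}\le D\|q_2-q_1\|_{H^4(\Omega)}$ for all $q_1,q_2\in\overline{B(R,g_0)}$. 3. There is $\alpha_0=\alpha_0(R,\Omega)\in(0,1/2]$ such that for every $\alpha\in(0,\alpha_0)$ there are $\lambda_1=\lambda_1(R,\Omega,\alpha)>1$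 and $C=C(R,\Omega,\alpha)>0$, depending only on the listed parameters, such that for all $g_0$ with $B(R,g_0)\neq\varnothing$, all $n$, all $\lambda\ge\lambda_1$ and all $\beta\in[2e^{-\lambda\alpha T},1)$ the functional $J^{(n)}_{\lambda,\beta}$ is strictly convex on $\overline{B(R,g_0)}$ and, whenever $q,\,q+h\in\overline{B(R,g_0)}$, $$J^{(n)}_{\lambda,\beta}(q+h)-J^{(n)}_{\lambda,\beta}(q)-\big(J^{(n)}_{\lambda,\beta}(q)\big)'(h)\ge C\int_\Omega\big[\lambda(h_x^2+h_t^2)+\lambda^3h^2\big]e^{2\lambda\varphi}dx\,dt+C\int_\varepsilon^b\big(\lambda h_x^2(x,0)+\lambda^3h^2(x,0)\big)e^{-2\lambda x}dx+\frac\beta2\|h\|^2_{H^4(\Omega)}.$$ 4. For the same $\alpha,\lambda,\beta,g_0,n$ there is a unique minimizer $q_{n,\min}\in\overline{B(R,g_0)}$ of $J^{(n)}_{\lambda,\beta}$ on $\overline{B(R,g_0)}$, and $$\big[\big(J^{(n)}_{\lambda,\beta}(q)\big)',\,q-q_{n,\min}\big]\ge0\qquad\text{for all }q\in\overline{B(R,g_0)}.$$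 -/

import Mathlib

open MeasureTheory Set
open scoped ContDiff

noncomputable section

namespace Carleman1D

/-- The open rectangle `Ω = (ε, b) × (0, T)` in the `(x, t)` plane. -/
def Om (ε b T : ℝ) : Set (ℝ × ℝ) := Ioo ε b ×ˢ Ioo 0 T

/-- The closed rectangle, the closure of `Ω`. -/
def OmBar (ε b T : ℝ) : Set (ℝ × ℝ) := Icc ε b ×ˢ Icc 0 T

/-- Lebesgue measure on `Ω`. -/
def muOm (ε b T : ℝ) : Measure (ℝ × ℝ) := (volume : Measure (ℝ × ℝ)).restrict (Om ε b T)

/-- The real space `L²(Ω)`. -/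
abbrev L2 (ε b T : ℝ) : Type := Lp ℝ 2 (muOm ε b T)

/-- Classical partial derivative in `x`. -/
def dX (φ : ℝ × ℝ → ℝ) : ℝ × ℝ → ℝ := fun z => fderiv ℝ φ z (1, 0)

/-- Classical partial derivative in `t`. -/
def dT (φ : ℝ × ℝ → ℝ) : ℝ × ℝ → ℝ := fun z => fderiv ℝ φ z (0, 1)

/-- Smooth functions with compact support inside `Ω`. -/
def IsTest (ε b T : ℝ) (φ : ℝ × ℝ → ℝ) : Prop :=
  ContDiff ℝ ∞ φ ∧ HasCompactSupport φ ∧ tsupport φ ⊆ Om ε b T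

/-- `w` is the weak derivative `∂ₓⁱ ∂ₜʲ u` on `Ω`. -/
def IsWeakDeriv (ε b T : ℝ) (i j : ℕ) (u w : L2 ε b T) : Prop :=
  ∀ φ : ℝ × ℝ → ℝ, IsTest ε b T φ →
    ∫ z, u z * (dX^[i] (dT^[j] φ)) z ∂(muOm ε b T)
      = (-1) ^ (i + j) * ∫ z, w z * φ z ∂(muOm ε b T)

/-- Multi-indices `(i, j)` with `i + j ≤ 4`. -/
abbrev Idx : Type := {p : Fin 5 × Fin 5 // (p.1 : ℕ) + (p.2 : ℕ) ≤ 4}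

/-- The multi-index `(0, 0)`. -/
def idx0 : Idx := ⟨(0, 0), by decide⟩

lemma dX_smooth {φ : ℝ × ℝ → ℝ} (h : ContDiff ℝ ∞ φ) : ContDiff ℝ ∞ (dX φ) :=
  (h.fderiv_right (m := ∞) (by simp)).clm_apply contDiff_const

lemma dT_smooth {φ : ℝ × ℝ → ℝ} (h : ContDiff ℝ ∞ φ) : ContDiff ℝ ∞ (dT φ) :=
  (h.fderiv_right (m := ∞) (by simp)).clm_apply contDiff_const

lemma dX_compact {φ : ℝ × ℝ → ℝ} (h : HasCompactSupport φ) : HasCompactSupport (dX φ) :=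
  h.fderiv_apply (𝕜 := ℝ) _

lemma dT_compact {φ : ℝ × ℝ → ℝ} (h : HasCompactSupport φ) : HasCompactSupport (dT φ) :=
  h.fderiv_apply (𝕜 := ℝ) _

lemma iter_good {φ : ℝ × ℝ → ℝ} (h : ContDiff ℝ ∞ φ) (hc : HasCompactSupport φ) (i j : ℕ) :
    ContDiff ℝ ∞ (dX^[i] (dT^[j] φ)) ∧ HasCompactSupport (dX^[i] (dT^[j] φ)) := by
  have h1 : ContDiff ℝ ∞ (dT^[j] φ) ∧ HasCompactSupport (dT^[j] φ) := by
    induction j with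
    | zero => exact ⟨h, hc⟩
    | succ k ih =>
      rw [Function.iterate_succ_apply']
      exact ⟨dT_smooth ih.1, dT_compact ih.2⟩
  induction i with
  | zero => exact h1
  | succ k ih =>
    rw [Function.iterate_succ_apply']
    exact ⟨dX_smooth ih.1, dX_compact ih.2⟩

lemma integrable_mul_test {ε b T : ℝ} (u : L2 ε b T) {ψ : ℝ × ℝ → ℝ} (h : ContDiff ℝ ∞ ψ)
    (hc : HasCompactSupport ψ) : Integrable (fun z => u z * ψ z) (muOm ε b T) := by
  have : IsFiniteMeasureOnCompacts (muOm ε b T) := by unfold muOm; infer_instance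
  exact MemLp.integrable_mul (p := 2) (q := 2) (Lp.memLp u) (h.continuous.memLp_of_hasCompactSupport hc)

lemma weak_zero {ε b T : ℝ} (i j : ℕ) : IsWeakDeriv ε b T i j 0 0 := by
  intro φ _
  have h0 : ∀ ψ : ℝ × ℝ → ℝ, ∫ z, (0 : L2 ε b T) z * ψ z ∂(muOm ε b T) = 0 := by
    intro ψ
    apply integral_eq_zero_of_ae
    filter_upwards [Lp.coeFn_zero ℝ 2 (muOm ε b T)] with z hz
    rw [hz]
    simp
  rw [h0, h0, mul_zero]

lemma weak_add {ε b T : ℝ} {i j : ℕ} {u w u' w' : L2 ε b T} (h : IsWeakDeriv ε b T i j u w)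
    (h' : IsWeakDeriv ε b T i j u' w') : IsWeakDeriv ε b T i j (u + u') (w + w') := by
  intro φ hφ
  have key : ∀ (a a' : L2 ε b T) (ψ : ℝ × ℝ → ℝ), ContDiff ℝ ∞ ψ → HasCompactSupport ψ →
      ∫ z, (a + a') z * ψ z ∂(muOm ε b T)
        = ∫ z, a z * ψ z ∂(muOm ε b T) + ∫ z, a' z * ψ z ∂(muOm ε b T) := by
    intro a a' ψ hs hc
    rw [← integral_add (integrable_mul_test a hs hc) (integrable_mul_test a' hs hc)]
    apply integral_congr_ae
    filter_upwards [Lp.coeFn_add a a'] with z hz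
    rw [hz, Pi.add_apply, add_mul]
  obtain ⟨g1, g2⟩ := iter_good hφ.1 hφ.2.1 i j
  rw [key u u' _ g1 g2, key w w' _ hφ.1 hφ.2.1, h φ hφ, h' φ hφ, mul_add]

lemma weak_smul {ε b T : ℝ} {i j : ℕ} {u w : L2 ε b T} (c : ℝ) (h : IsWeakDeriv ε b T i j u w) :
    IsWeakDeriv ε b T i j (c • u) (c • w) := by
  intro φ hφ
  have key : ∀ (a : L2 ε b T) (ψ : ℝ × ℝ → ℝ),
      ∫ z, (c • a) z * ψ z ∂(muOm ε b T) = c * ∫ z, a z * ψ z ∂(muOm ε b T) := by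
    intro a ψ
    rw [← integral_const_mul]
    apply integral_congr_ae
    filter_upwards [Lp.coeFn_smul c a] with z hz
    rw [hz, Pi.smul_apply, smul_eq_mul, mul_assoc]
  rw [key, key, h φ hφ]
  ring

/-- The Sobolev space `H⁴(Ω)`. A function `u ∈ H⁴(Ω)` is recorded together with all its weak
derivatives of order at most 4, as the family `(∂ₓⁱ ∂ₜʲ u)` in `L²(Ω)`; the component `(0, 0)`
is `u` and determines the others. The inherited scalar product is
`[u, v] = ∑_{i + j ≤ 4} ∫_Ω ∂ₓⁱ∂ₜʲ u · ∂ₓⁱ∂ₜʲ v`. -/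
def H4Sub (ε b T : ℝ) : Submodule ℝ (PiLp 2 (fun _ : Idx => L2 ε b T)) where
  carrier := {U | ∀ k : Idx, IsWeakDeriv ε b T (k.1.1 : ℕ) (k.1.2 : ℕ) (U idx0) (U k)}
  zero_mem' := fun _ => weak_zero _ _
  add_mem' := fun h h' k => weak_add (h k) (h' k)
  smul_mem' := fun c _ h k => weak_smul c (h k)

/-- `H⁴(Ω)` as a type, with norm and scalar product. -/
def H4 (ε b T : ℝ) : Type := ↥(H4Sub ε b T)

instance (ε b T : ℝ) : NormedAddCommGroup (H4 ε b T) :=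
  inferInstanceAs (NormedAddCommGroup ↥(H4Sub ε b T))

instance (ε b T : ℝ) : InnerProductSpace ℝ (H4 ε b T) :=
  inferInstanceAs (InnerProductSpace ℝ ↥(H4Sub ε b T))

/-- The weak derivative `∂ₓⁱ ∂ₜʲ u ∈ L²(Ω)` of `u ∈ H⁴(Ω)`. -/
def H4.D {ε b T : ℝ} (u : H4 ε b T) (i j : Fin 5) (h : (i : ℕ) + (j : ℕ) ≤ 4 := by decide) :
    L2 ε b T :=
  (Subtype.val (p := fun U => U ∈ H4Sub ε b T) u) ⟨(i, j), h⟩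

/-- `f` is a representative of `u` that is continuous on the closed rectangle; its values on the
closed rectangle, in particular on the boundary, are determined by `u`. -/
def IsContRep (ε b T : ℝ) (u : L2 ε b T) (f : ℝ × ℝ → ℝ) : Prop :=
  ContinuousOn f (OmBar ε b T) ∧ u =ᵐ[muOm ε b T] f

open Classical in
/-- The continuous representative of `u` (which exists for `u` and its derivatives of order at
most 2 if `u ∈ H⁴(Ω)`), used to give a meaning to values on the boundary. -/
def contRep {ε b T : ℝ} (u : L2 ε b T) : ℝ × ℝ → ℝ :=
  if h : ∃ f, IsContRep ε b T u f then h.choose else 0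

lemma contRep_add {ε b T : ℝ} {u v : L2 ε b T} {f g : ℝ × ℝ → ℝ} (hf : IsContRep ε b T u f)
    (hg : IsContRep ε b T v g) : IsContRep ε b T (u + v) (f + g) :=
  ⟨hf.1.add hg.1, (Lp.coeFn_add u v).trans (hf.2.add hg.2)⟩

lemma contRep_smul {ε b T : ℝ} {u : L2 ε b T} {f : ℝ × ℝ → ℝ} (c : ℝ)
    (hf : IsContRep ε b T u f) : IsContRep ε b T (c • u) (c • f) :=
  ⟨hf.1.const_smul c, (Lp.coeFn_smul c u).trans (hf.2.const_smul c)⟩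

/-- The subspace `H⁴₀(Ω)` of all `v ∈ H⁴(Ω)` with `v(ε, t) = vₓ(ε, t) = vₓ(b, t) = 0`. -/
def H40 (ε b T : ℝ) : Submodule ℝ (H4 ε b T) where
  carrier := {v | ∃ f fx : ℝ × ℝ → ℝ, IsContRep ε b T (v.D 0 0) f ∧ IsContRep ε b T (v.D 1 0) fx ∧
    ∀ t ∈ Ioo 0 T, f (ε, t) = 0 ∧ fx (ε, t) = 0 ∧ fx (b, t) = 0}
  zero_mem' := ⟨0, 0, ⟨continuousOn_const, Lp.coeFn_zero ℝ 2 (muOm ε b T)⟩,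
    ⟨continuousOn_const, Lp.coeFn_zero ℝ 2 (muOm ε b T)⟩, fun _ _ => ⟨rfl, rfl, rfl⟩⟩
  add_mem' := by
    rintro u v ⟨f, fx, h1, h2, h3⟩ ⟨g, gx, k1, k2, k3⟩
    refine ⟨f + g, fx + gx, contRep_add h1 k1, contRep_add h2 k2, fun t ht => ?_⟩
    obtain ⟨a1, a2, a3⟩ := h3 t ht
    obtain ⟨b1, b2, b3⟩ := k3 t ht
    simp [a1, a2, a3, b1, b2, b3]
  smul_mem' := by
    rintro c v ⟨f, fx, h1, h2, h3⟩
    refine ⟨c • f, c • fx, contRep_smul c h1, contRep_smul c h2, fun t ht => ?_⟩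
    obtain ⟨a1, a2, a3⟩ := h3 t ht
    simp [a1, a2, a3]

/-- The lower bound `1 / (2 b^{1/4})` for `q(x, 0)`. -/
def qLow (b : ℝ) : ℝ := 1 / (2 * b ^ (1 / 4 : ℝ))

/-- The set `B(R, g₀)`. -/
def admB (ε b T R : ℝ) (g₀ : ℝ → ℝ) : Set (H4 ε b T) :=
  {q | ‖q‖ < R ∧ ∃ f fx : ℝ × ℝ → ℝ,
    IsContRep ε b T (q.D 0 0) f ∧ IsContRep ε b T (q.D 1 0) fx ∧
    (∀ t ∈ Ioo 0 T, f (ε, t) = g₀ (t + ε) ∧ fx (ε, t) = 2 * deriv g₀ (t + ε) ∧ fx (b, t) = 0) ∧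
    ∀ x ∈ Icc ε b, qLow b ≤ f (x, 0) ∧ f (x, 0) ≤ 1 / 2}

/-- The truncation `q⁰(x, 0)` of `q(x, 0)` to the interval `[1 / (2 b^{1/4}), 1 / 2]`. -/
def qTrunc {ε b T : ℝ} (q : H4 ε b T) (x : ℝ) : ℝ :=
  max (qLow b) (min (1 / 2) (contRep (q.D 0 0) (x, 0)))

/-- The coefficient of `-q_{xt}` in `Aₙ`: it is `2` for `n = 0`, and it is built from the previous
minimizer `m (n - 1)` for `n ≥ 1`. -/
def coefA {ε b T : ℝ} (m : ℕ → H4 ε b T) : ℕ → ℝ → ℝ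
  | 0, _ => 2
  | k + 1, x => 1 / (2 * qTrunc (m k) x ^ 2)

/-- The operator `Aₙ(q) = q_{xx} - (coefficient) q_{xt}`. -/
def opA {ε b T : ℝ} (m : ℕ → H4 ε b T) (n : ℕ) (q : H4 ε b T) (z : ℝ × ℝ) : ℝ :=
  (q.D 2 0) z - coefA m n z.1 * (q.D 1 1) z

/-- The free term `Bₙ`: it is `0` for `n = 0`, and it is built from the previous minimizer
`m (n - 1)` for `n ≥ 1`. -/
def termB {ε b T : ℝ} (m : ℕ → H4 ε b T) : ℕ → ℝ × ℝ → ℝ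
  | 0, _ => 0
  | k + 1, z =>
    ((m k).D 0 1) z * (contRep ((m k).D 1 0) (z.1, 0) / (2 * qTrunc (m k) z.1 ^ 3))

/-- The Carleman weight `e^{2λφ} = e^{-2λ(x + αt)}`. -/
def weight (α lam : ℝ) (z : ℝ × ℝ) : ℝ := Real.exp (-2 * lam * (z.1 + α * z.2))

/-- The functional `J⁽ⁿ⁾_{λ,β}`; for `n ≥ 1` it depends on `m (n - 1)`. -/
def J {ε b T : ℝ} (α lam β : ℝ) (m : ℕ → H4 ε b T) (n : ℕ) (q : H4 ε b T) : ℝ :=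
  (∫ z in Om ε b T, (opA m n q z + termB m n z) ^ 2 * weight α lam z) + β * ‖q‖ ^ 2

/-- `p` is a minimizer of `F` on `S`. -/
def IsMinimizer {E : Type} (F : E → ℝ) (S : Set E) (p : E) : Prop :=
  p ∈ S ∧ ∀ q ∈ S, F p ≤ F q

/-- `m 0, …, m (n - 1)` are the minimizers, constructed one after the other, of the functionals
`J⁽⁰⁾, …, J⁽ⁿ⁻¹⁾` on the closure of `B(R, g₀)`. -/
def IsIteration {ε b T : ℝ} (R : ℝ) (g₀ : ℝ → ℝ) (α lam β : ℝ) (n : ℕ) (m : ℕ → H4 ε b T) : Prop :=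
  ∀ k < n, IsMinimizer (J α lam β m k) (closure (admB ε b T R g₀)) (m k)

/-- `g ∈ H⁴₀(Ω)` is the Fréchet derivative of `F` at `q` along `H⁴₀(Ω)`, identified with an
element of `H⁴₀(Ω)` through the scalar product of `H⁴(Ω)`:
`F(q + h) = F(q) + [g, h] + o(‖h‖)` for `h ∈ H⁴₀(Ω)`. -/
def IsFrechetDeriv {ε b T : ℝ} (F : H4 ε b T → ℝ) (q : H4 ε b T) (g : H40 ε b T) : Prop :=
  HasFDerivAt (fun h : H40 ε b T => F (q + (h : H4 ε b T))) (innerSL ℝ g) 0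

end Carleman1D

end

open Carleman1D

noncomputable section

namespace Carleman1D

/-! Once the previous minimizers are fixed, `J` is a quadratic functional ‖A q + B‖² + β‖q‖² on a
Hilbert space, with A : H⁴ → L² bounded and equal to the square root of the weight times `opA`.
Hence J(q + h) = J(q) + J'(q)h + ‖A h‖² + β‖h‖² exactly (`quadF_add`). The gradient is given by the
Riesz theorem on H⁴₀ and is Lipschitz in q. For β > 0 strict convexity is visible. A minimizer is a
nearest point in the closed convex image of the admissible set under q ↦ (A q, √β q). The
variational inequality is the expansion at q with h = p - q, where p is the minimizer.

The analytic core is a Carleman lower bound for ‖A h‖² (`carleman_H40`). With v = hₓ the operator is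
the transport operator vₓ - c(x) vₜ with c ∈ [2, `cMax b`]. It is multiplied by λ v times the weight
and integrated by parts (`carleman_transport`). Since v = 0 on both lateral sides, the x-part yields
λ²∫v². The t-part costs at most half of this when α `cMax b` ≤ 1/2, gives a term of good sign at t =
0 and one of bad sign at t = T. A Hardy inequality in x with exponential weight (`hardy_exp`) then
bounds h through hₓ, and bounds v - c hₜ, hence hₜ, through the operator itself
(`carleman_time_derivative`). The weight at t = T is at most e^{-2λαT} and |hₓ| ≤ C‖h‖, so half of
the penalty β‖h‖² absorbs the bad term for large λ. All constants are uniform in n, because the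
truncation keeps c in a fixed interval and the bound R on earlier minimizers fixes its Lipschitz
constant.

These computations need classical boundary values. The embedding of H⁴ in C² is obtained from the
formula u(x) = ∫ η u + ∫ ker(x, ·) u', applied in x and in t (`exists_continuous_rep`,
`exists_classicalRep`). -/

/-! ### The one-dimensional representation kernel. -/

/-- A smooth step on `(a, b)`: it is `0` near `a` and `1` near `b`. -/
def cutE (a b x : ℝ) : ℝ := Real.smoothTransition (3 * (x - a) / (b - a) - 1)

/-- The derivative of the step `cutE a b`. -/
def eta (a b : ℝ) : ℝ → ℝ := deriv (cutE a b)

/-- The kernel of the representation formula `u(x) = ∫ η u + ∫ ker(x, ·) u'`. -/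
def ker (a b x s : ℝ) : ℝ := cutE a b s - (Ici x).indicator 1 s

lemma cutE_contDiff (a b : ℝ) : ContDiff ℝ ∞ (cutE a b) := by
  unfold cutE
  exact Real.smoothTransition.contDiff.comp (by fun_prop)

lemma cutE_nonneg (a b x : ℝ) : 0 ≤ cutE a b x := Real.smoothTransition.nonneg _

lemma cutE_le_one (a b x : ℝ) : cutE a b x ≤ 1 := Real.smoothTransition.le_one _

lemma cutE_eq_zero {a b x : ℝ} (hab : a < b) (hx : x ≤ a + (b - a) / 3) : cutE a b x = 0 := by
  apply Real.smoothTransition.zero_of_nonpos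
  have : 3 * (x - a) / (b - a) ≤ 1 := by
    rw [div_le_one (by linarith)]; linarith
  linarith

lemma cutE_eq_one {a b x : ℝ} (hab : a < b) (hx : b - (b - a) / 3 ≤ x) : cutE a b x = 1 := by
  apply Real.smoothTransition.one_of_one_le
  have : 2 ≤ 3 * (x - a) / (b - a) := by
    rw [le_div_iff₀ (by linarith)]; linarith
  linarith

lemma cutE_hasDerivAt (a b x : ℝ) : HasDerivAt (cutE a b) (eta a b x) x :=
  ((cutE_contDiff a b).differentiable (by simp) x).hasDerivAt

lemma eta_continuous (a b : ℝ) : Continuous (eta a b) :=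
  (cutE_contDiff a b).continuous_deriv (by simp)

/-- The requirement B ≥ 1 lets the same constant dominate `ker`, whose values lie in [-1, 1]. -/
lemma eta_bound {a b : ℝ} (hab : a < b) : ∃ B : ℝ, 1 ≤ B ∧ ∀ x, |eta a b x| ≤ B := by
  have h0 : ∀ x ∉ Icc a b, eta a b x = 0 := by
    intro x hx
    rcases not_and_or.1 hx with h | h <;> push Not at h
    · have : cutE a b =ᶠ[nhds x] fun _ => 0 := by
        filter_upwards [Iio_mem_nhds h] with y hy
        exact cutE_eq_zero hab (by have : y < a := hy; linarith)
      rw [eta, this.deriv_eq]; simp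
    · have : cutE a b =ᶠ[nhds x] fun _ => 1 := by
        filter_upwards [Ioi_mem_nhds h] with y hy
        exact cutE_eq_one hab (by have : b < y := hy; linarith)
      rw [eta, this.deriv_eq]; simp
  have hc : HasCompactSupport (eta a b) := HasCompactSupport.intro isCompact_Icc h0
  obtain ⟨C, hC⟩ := hc.exists_bound_of_continuous (eta_continuous a b)
  exact ⟨max C 1, le_max_right _ _, fun x => (hC x).trans (le_max_left _ _)⟩

lemma abs_ker_le (a b x s : ℝ) : |ker a b x s| ≤ 1 := by
  have h1 := cutE_nonneg a b s
  have h2 := cutE_le_one a b s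
  unfold ker indicator
  split_ifs <;> rw [abs_le] <;> constructor <;> simp <;> linarith

lemma measurable_ker {X : Type*} [MeasurableSpace X] {f g : X → ℝ} (a b : ℝ) (hf : Measurable f)
    (hg : Measurable g) : Measurable fun x => ker a b (f x) (g x) := by
  have : (fun p => ker a b (f p) (g p)) =
      fun p => cutE a b (g p) - {p | f p ≤ g p}.indicator 1 p := by
    ext p; simp [ker, indicator]
  rw [this]
  exact ((cutE_contDiff a b).continuous.measurable.comp hg).sub
    (measurable_one.indicator (measurableSet_le hf hg))

/-- The kernel jumps only on the diagonal, which is negligible in s; this is what makes dominated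
convergence applicable to the reconstructed functions. -/
lemma ker_continuousAt {a b x s : ℝ} (h : s ≠ x) : ContinuousAt (fun y => ker a b y s) x := by
  rcases lt_or_gt_of_ne h with h | h
  · have : (fun y => ker a b y s) =ᶠ[nhds x] fun _ => cutE a b s := by
      filter_upwards [Ioi_mem_nhds h] with y hy
      have : s < y := hy
      simp [ker, this]
    exact continuousAt_const.congr this.symm
  · have : (fun y => ker a b y s) =ᶠ[nhds x] fun _ => cutE a b s - 1 := by
      filter_upwards [Iio_mem_nhds h] with y hy
      have : y < s := hy
      simp [ker, indicator, this.le]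
    exact continuousAt_const.congr this.symm

/-! ### Test functions under the transposed kernel. -/

/-- The ends A and B are pushed into the outer thirds of the interval, where `cutE` is already
constant: it is 0 to the left of A and 1 to the right of B. -/
lemma compact_subset_Icc {a b : ℝ} {K : Set ℝ} (hK : IsCompact K) (hKs : K ⊆ Ioo a b)
    (hab : a < b) : ∃ A B, a < A ∧ A ≤ a + (b - a) / 3 ∧ b - (b - a) / 3 ≤ B ∧ B < b ∧
      K ⊆ Icc A B := by
  rcases K.eq_empty_or_nonempty with rfl | hne
  · exact ⟨a + (b - a) / 3, b - (b - a) / 3, by linarith, le_rfl, le_rfl, by linarith, by simp⟩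
  · obtain ⟨l, hl, hl'⟩ := hK.exists_isLeast hne
    obtain ⟨u, hu, hu'⟩ := hK.exists_isGreatest hne
    refine ⟨min l (a + (b - a) / 3), max u (b - (b - a) / 3),
      lt_min (hKs hl).1 (by linarith), min_le_right _ _, le_max_right _ _,
      max_lt (hKs hu).2 (by linarith), fun x hx => ⟨?_, ?_⟩⟩
    · exact (min_le_left _ _).trans (hl' hx)
    · exact (hu' hx).trans (le_max_left _ _)

/-- The primitive in `x` of a compactly supported function. -/
def prim (φ : ℝ × ℝ → ℝ) (z : ℝ × ℝ) : ℝ := ∫ x in Iic z.1, φ (x, z.2)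

lemma section_hasCompactSupport {φ : ℝ × ℝ → ℝ} (hc : HasCompactSupport φ) (t : ℝ) :
    HasCompactSupport fun x => φ (x, t) := by
  refine HasCompactSupport.intro (hc.isCompact.image continuous_fst) fun x hx => ?_
  by_contra h
  exact hx ⟨(x, t), subset_tsupport _ h, rfl⟩

lemma section_integrable {φ : ℝ × ℝ → ℝ} (h : Continuous φ) (hc : HasCompactSupport φ) (t : ℝ) :
    Integrable fun x => φ (x, t) :=
  Continuous.integrable_of_hasCompactSupport (by fun_prop) (section_hasCompactSupport hc t)

/-- The primitive is a convolution in x with the Heaviside function, t being a parameter, so joint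
smoothness follows from that of parametrized convolutions. -/
lemma prim_contDiff {φ : ℝ × ℝ → ℝ} (h : ContDiff ℝ ∞ φ) (hc : HasCompactSupport φ) :
    ContDiff ℝ ∞ (prim φ) := by
  have hH : LocallyIntegrable ((Ici (0 : ℝ)).indicator (1 : ℝ → ℝ)) :=
    (locallyIntegrable_const (1 : ℝ)).indicator measurableSet_Ici
  have key := contDiffOn_convolution_right_with_param (𝕜 := ℝ) (μ := volume) (n := ⊤)
    (f := (Ici (0 : ℝ)).indicator (1 : ℝ → ℝ)) (ContinuousLinearMap.mul ℝ ℝ)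
    (g := fun t x => φ (x, t)) (s := univ) (k := Prod.fst '' tsupport φ) isOpen_univ
    (hc.isCompact.image continuous_fst)
    (fun t x _ hx => by
      by_contra h
      exact hx ⟨(x, t), subset_tsupport _ h, rfl⟩) hH
    (by
      apply ContDiff.contDiffOn
      exact h.comp (contDiff_snd.prodMk contDiff_fst))
  rw [univ_prod_univ, contDiffOn_univ] at key
  have e : prim φ = (fun q : ℝ × ℝ => (convolution ((Ici (0 : ℝ)).indicator (1 : ℝ → ℝ))
      ((fun t x => φ (x, t)) q.1) (ContinuousLinearMap.mul ℝ ℝ) volume) q.2) ∘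
        fun z : ℝ × ℝ => (z.2, z.1) := by
    ext z
    simp only [prim, Function.comp, convolution, ContinuousLinearMap.mul_apply']
    rw [← integral_sub_left_eq_self _ volume z.1, ← integral_indicator measurableSet_Iic]
    congr 1
    ext x
    by_cases hx : x ≤ z.1 <;> simp [indicator, hx]
  rw [e]
  exact key.comp (contDiff_snd.prodMk contDiff_fst)

lemma prim_hasDerivAt {φ : ℝ × ℝ → ℝ} (h : Continuous φ) (hc : HasCompactSupport φ) (s t : ℝ) :
    HasDerivAt (fun s => prim φ (s, t)) (φ (s, t)) s := by
  have hi := section_integrable h hc t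
  have e : (fun s => prim φ (s, t)) =
      fun s => prim φ (0, t) + ∫ x in (0 : ℝ)..s, φ (x, t) := by
    ext s
    simp only [prim]
    rw [← intervalIntegral.integral_Iic_sub_Iic hi.integrableOn hi.integrableOn]
    ring
  rw [e]
  apply HasDerivAt.const_add
  have hcs : Continuous fun x => φ (x, t) := by fun_prop
  exact intervalIntegral.integral_hasDerivAt_right (hcs.intervalIntegrable _ _)
    (hcs.stronglyMeasurableAtFilter _ _) hcs.continuousAt

lemma dX_eq_of_hasDerivAt {φ : ℝ × ℝ → ℝ} (h : ContDiff ℝ ∞ φ) {s t d : ℝ}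
    (hd : HasDerivAt (fun s => φ (s, t)) d s) : dX φ (s, t) = d := by
  have h1 : HasFDerivAt φ (fderiv ℝ φ (s, t)) (s, t) :=
    (h.differentiable (by simp) _).hasFDerivAt
  have h2 : HasDerivAt (fun s : ℝ => (s, t)) ((1 : ℝ), (0 : ℝ)) s :=
    (hasDerivAt_id s).prodMk (hasDerivAt_const s t)
  exact (h1.comp_hasDerivAt s h2).unique hd

/-- The transpose of the representation kernel, applied to a test function. -/
def kerTest (a b : ℝ) (φ : ℝ × ℝ → ℝ) (z : ℝ × ℝ) : ℝ :=
  cutE a b z.1 * prim φ (b, z.2) - prim φ z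

lemma tsupport_fst_snd {U V : Set ℝ} {φ : ℝ × ℝ → ℝ} (hs : tsupport φ ⊆ U ×ˢ V) :
    Prod.fst '' tsupport φ ⊆ U ∧ Prod.snd '' tsupport φ ⊆ V :=
  ⟨by rintro _ ⟨z, hz, rfl⟩; exact (hs hz).1, by rintro _ ⟨z, hz, rfl⟩; exact (hs hz).2⟩

lemma prim_right {a b c d : ℝ} {φ : ℝ × ℝ → ℝ} (hs : tsupport φ ⊆ Ioo a b ×ˢ Ioo c d) (t : ℝ) :
    prim φ (b, t) = ∫ x in Ioo a b, φ (x, t) := by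
  have hz : ∀ x ∉ Ioo a b, φ (x, t) = 0 := by
    intro x hx
    by_contra h
    exact hx (hs (subset_tsupport _ h)).1
  rw [prim, setIntegral_eq_integral_of_forall_compl_eq_zero,
    setIntegral_eq_integral_of_forall_compl_eq_zero hz]
  intro x hx
  exact hz x fun h => hx h.2.le

/-- A primitive of a test function need not vanish on the right; subtracting it from `cutE` times
its total mass restores compact support. To the left of the support both terms vanish, to the right
they cancel. -/
lemma kerTest_isTest {a b c d : ℝ} (hab : a < b) {φ : ℝ × ℝ → ℝ} (h : ContDiff ℝ ∞ φ)
    (hc : HasCompactSupport φ) (hs : tsupport φ ⊆ Ioo a b ×ˢ Ioo c d) :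
    ContDiff ℝ ∞ (kerTest a b φ) ∧ HasCompactSupport (kerTest a b φ) ∧
      tsupport (kerTest a b φ) ⊆ Ioo a b ×ˢ Ioo c d := by
  have hsm : ContDiff ℝ ∞ (kerTest a b φ) := by
    have h1 : ContDiff ℝ ∞ fun z : ℝ × ℝ => prim φ (b, z.2) :=
      (prim_contDiff h hc).comp (contDiff_const.prodMk contDiff_snd)
    exact (((cutE_contDiff a b).comp contDiff_fst).mul h1).sub (prim_contDiff h hc)
  have hK1 := hc.isCompact.image continuous_fst
  have hK2 := hc.isCompact.image continuous_snd
  obtain ⟨A, B, haA, hA, hB, hBb, hAB⟩ :=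
    compact_subset_Icc hK1 (tsupport_fst_snd hs).1 hab
  have hout : ∀ x t, φ (x, t) ≠ 0 → x ∈ Icc A B ∧ t ∈ Prod.snd '' tsupport φ := fun x t hx =>
    ⟨hAB ⟨_, subset_tsupport _ hx, rfl⟩, ⟨_, subset_tsupport _ hx, rfl⟩⟩
  set K := Icc A B ×ˢ (Prod.snd '' tsupport φ) with hK
  have hKc : IsCompact K := isCompact_Icc.prod hK2
  have hzero : ∀ z ∉ K, kerTest a b φ z = 0 := by
    rintro ⟨s, t⟩ hz
    by_cases ht : t ∈ Prod.snd '' tsupport φ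
    · have hsI : s ∉ Icc A B := fun h => hz ⟨h, ht⟩
      rcases not_and_or.1 hsI with h1 | h1 <;> push Not at h1
      · have e1 : prim φ (s, t) = 0 := by
          apply setIntegral_eq_zero_of_forall_eq_zero
          intro x hx
          by_contra hne
          have := (hout x t hne).1.1
          have : x ≤ s := hx
          linarith
        simp [kerTest, e1, cutE_eq_zero hab (h1.le.trans hA)]
      · have e1 : prim φ (s, t) = prim φ (b, t) := by
          simp only [prim]
          rw [setIntegral_eq_integral_of_forall_compl_eq_zero,
            setIntegral_eq_integral_of_forall_compl_eq_zero] <;>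
          · intro x hx
            by_contra hne
            have h3 := (hout x t hne).1.2
            simp only [mem_Iic, not_le] at hx
            linarith
        simp [kerTest, e1, cutE_eq_one hab (hB.trans h1.le)]
    · have h0 : ∀ x, φ (x, t) = 0 := fun x => by
        by_contra hne
        exact ht (hout x t hne).2
      simp [kerTest, prim, h0]
  refine ⟨hsm, HasCompactSupport.intro hKc hzero, ?_⟩
  refine (closure_minimal (fun z hz => ?_) hKc.isClosed).trans (?_ : K ⊆ _)
  · by_contra h'
    exact hz (hzero z h')
  · exact prod_mono (fun x hx => ⟨haA.trans_le hx.1, hx.2.trans_lt hBb⟩) (tsupport_fst_snd hs).2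

lemma dX_kerTest {a b c d : ℝ} (hab : a < b) {φ : ℝ × ℝ → ℝ} (h : ContDiff ℝ ∞ φ)
    (hc : HasCompactSupport φ) (hs : tsupport φ ⊆ Ioo a b ×ˢ Ioo c d) (z : ℝ × ℝ) :
    dX (kerTest a b φ) z = eta a b z.1 * prim φ (b, z.2) - φ z := by
  obtain ⟨s, t⟩ := z
  exact dX_eq_of_hasDerivAt (kerTest_isTest hab h hc hs).1
    (((cutE_hasDerivAt a b s).mul_const (prim φ (b, t))).fun_sub (prim_hasDerivAt h.continuous hc s t))

lemma kerTest_eq_integral {a b c d : ℝ} {φ : ℝ × ℝ → ℝ} (h : Continuous φ)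
    (hc : HasCompactSupport φ) (hs : tsupport φ ⊆ Ioo a b ×ˢ Ioo c d) (s t : ℝ) :
    kerTest a b φ (s, t) = ∫ x in Ioo a b, ker a b x s * φ (x, t) := by
  have hi := section_integrable h hc t
  have hz : ∀ x ∉ Ioo a b, φ (x, t) = 0 := by
    intro x hx
    by_contra h
    exact hx (hs (subset_tsupport _ h)).1
  have e : ∀ x, ker a b x s * φ (x, t) =
      cutE a b s * φ (x, t) - (Iic s).indicator (fun x => φ (x, t)) x := by
    intro x
    by_cases hx : x ≤ s <;> simp [ker, indicator, hx]
    ring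
  simp_rw [kerTest, prim_right hs, e]
  rw [integral_sub (hi.integrableOn.const_mul _)
    ((hi.indicator measurableSet_Iic).integrableOn), integral_const_mul, prim]
  congr 1
  have e2 : ∫ x in Ioo a b, (Iic s).indicator (fun x => φ (x, t)) x =
      ∫ x, (Iic s).indicator (fun x => φ (x, t)) x :=
    setIntegral_eq_integral_of_forall_compl_eq_zero fun x hx => by simp [indicator, hz x hx]
  rw [e2, integral_indicator measurableSet_Iic]

/-! ### Weak derivatives on a rectangle and reconstruction formulas. -/

/-- Lebesgue measure on the interval `(a, b)`. -/
abbrev mI (a b : ℝ) : Measure ℝ := volume.restrict (Ioo a b)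

lemma prod_mI (a b c d : ℝ) :
    (mI a b).prod (mI c d) = (volume : Measure (ℝ × ℝ)).restrict (Ioo a b ×ˢ Ioo c d) := by
  rw [Measure.prod_restrict, Measure.volume_eq_prod]

/-- `v` is the weak derivative `∂ₓ u` on the rectangle `(a, b) × (c, d)`. -/
def WeakX (a b c d : ℝ) (u v : ℝ × ℝ → ℝ) : Prop :=
  ∀ φ : ℝ × ℝ → ℝ, ContDiff ℝ ∞ φ → HasCompactSupport φ → tsupport φ ⊆ Ioo a b ×ˢ Ioo c d →
    ∫ z, u z * dX φ z ∂((mI a b).prod (mI c d)) = -∫ z, v z * φ z ∂((mI a b).prod (mI c d))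

/-- `v` is the weak derivative `∂ₜ u` on the rectangle `(a, b) × (c, d)`. -/
def WeakT (a b c d : ℝ) (u v : ℝ × ℝ → ℝ) : Prop :=
  ∀ φ : ℝ × ℝ → ℝ, ContDiff ℝ ∞ φ → HasCompactSupport φ → tsupport φ ⊆ Ioo a b ×ˢ Ioo c d →
    ∫ z, u z * dT φ z ∂((mI a b).prod (mI c d)) = -∫ z, v z * φ z ∂((mI a b).prod (mI c d))

/-- The function reconstructed from `u` and its `x`-derivative `v`. -/
def repX (a b : ℝ) (u v : ℝ × ℝ → ℝ) (z : ℝ × ℝ) : ℝ :=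
  ∫ s, (eta a b s * u (s, z.2) + ker a b z.1 s * v (s, z.2)) ∂(mI a b)

lemma repX_integrand_measurable {a b : ℝ} {u v : ℝ × ℝ → ℝ} (hu : Measurable u)
    (hv : Measurable v) : Measurable fun p : (ℝ × ℝ) × ℝ =>
      eta a b p.2 * u (p.2, p.1.2) + ker a b p.1.1 p.2 * v (p.2, p.1.2) := by
  have h1 : Measurable (eta a b) := (eta_continuous a b).measurable
  have h2 : Measurable fun p : (ℝ × ℝ) × ℝ => ker a b p.1.1 p.2 :=
    measurable_ker a b (by fun_prop) (by fun_prop)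
  fun_prop

lemma repX_integrable {a b c d : ℝ} (hab : a < b) {u v : ℝ × ℝ → ℝ} (hu : Measurable u)
    (hv : Measurable v) (hui : Integrable u ((mI a b).prod (mI c d)))
    (hvi : Integrable v ((mI a b).prod (mI c d))) :
    Integrable (repX a b u v) ((mI a b).prod (mI c d)) := by
  obtain ⟨B, hB1, hBe⟩ := eta_bound hab
  have hB : 0 < B := by linarith
  have hm : AEStronglyMeasurable (repX a b u v) ((mI a b).prod (mI c d)) :=
    (repX_integrand_measurable hu hv).stronglyMeasurable.integral_prod_right.aestronglyMeasurable
  have hdom : Integrable (fun z : ℝ × ℝ => ∫ s, (B * |u (s, z.2)| + |v (s, z.2)|) ∂(mI a b))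
      ((mI a b).prod (mI c d)) :=
    (((hui.abs.const_mul B).add hvi.abs).swap.integral_prod_left).comp_snd (mI a b)
  refine hdom.mono' hm ?_
  have hae : ∀ᵐ t ∂(mI c d), Integrable (fun s => u (s, t)) (mI a b) ∧
      Integrable (fun s => v (s, t)) (mI a b) := hui.prod_left_ae.and hvi.prod_left_ae
  filter_upwards [Measure.quasiMeasurePreserving_snd.ae hae] with z hz
  refine norm_integral_le_of_norm_le ((hz.1.abs.const_mul B).add hz.2.abs)
    (Filter.Eventually.of_forall fun s => ?_)
  rw [Real.norm_eq_abs]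
  refine (abs_add_le _ _).trans ?_
  rw [abs_mul, abs_mul]
  have h1 := mul_le_mul_of_nonneg_right (hBe s) (abs_nonneg (u (s, z.2)))
  have h2 := mul_le_mul_of_nonneg_right (abs_ker_le a b z.1 s) (abs_nonneg (v (s, z.2)))
  linarith

lemma test_bound {φ : ℝ × ℝ → ℝ} (h : Continuous φ) (hc : HasCompactSupport φ) :
    ∃ C, ∀ z, ‖φ z‖ ≤ C := hc.exists_bound_of_continuous h

/-- Fubini in (x, s), for almost every fixed t, moves the kernel from u and v onto the test
function. -/
lemma integral_repX_mul_test {a b c d : ℝ} (hab : a < b) {u v φ : ℝ × ℝ → ℝ} (hu : Measurable u)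
    (hv : Measurable v) (hui : Integrable u ((mI a b).prod (mI c d)))
    (hvi : Integrable v ((mI a b).prod (mI c d))) (h : ContDiff ℝ ∞ φ)
    (hc : HasCompactSupport φ) (hs : tsupport φ ⊆ Ioo a b ×ˢ Ioo c d) :
    ∫ z, repX a b u v z * φ z ∂((mI a b).prod (mI c d)) =
      ∫ z, (u z * (eta a b z.1 * prim φ (b, z.2)) + v z * kerTest a b φ z)
        ∂((mI a b).prod (mI c d)) := by
  obtain ⟨C, hC⟩ := test_bound h.continuous hc
  obtain ⟨B, hB1, hBe⟩ := eta_bound hab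
  have hB : 0 < B := by linarith
  have hC0 : 0 ≤ C := (norm_nonneg _).trans (hC 0)
  have hpc := (prim_contDiff h hc).continuous
  have hkt := kerTest_isTest hab h hc hs
  have hp : ∀ t, |prim φ (b, t)| ≤ C * (b - a) := by
    intro t
    rw [prim_right hs]
    have := norm_setIntegral_le_of_norm_le_const (μ := volume) (s := Ioo a b)
      (f := fun x => φ (x, t)) (C := C) (by simp) (fun x _ => hC (x, t))
    simpa [Measure.real, hab.le] using this
  obtain ⟨C', hC'⟩ := test_bound hkt.1.continuous hkt.2.1
  have hi1 : Integrable (fun z => u z * (eta a b z.1 * prim φ (b, z.2)))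
      ((mI a b).prod (mI c d)) := by
    refine hui.mul_bdd (c := B * (C * (b - a))) ?_ (Filter.Eventually.of_forall fun z => ?_)
    · have := eta_continuous a b
      exact (by fun_prop : Continuous fun z : ℝ × ℝ =>
        eta a b z.1 * prim φ (b, z.2)).aestronglyMeasurable
    · rw [norm_mul]
      exact mul_le_mul (hBe _) (hp _) (norm_nonneg _) hB.le
  have hi2 : Integrable (fun z => v z * kerTest a b φ z) ((mI a b).prod (mI c d)) :=
    hvi.mul_bdd (c := C') hkt.1.continuous.aestronglyMeasurable (Filter.Eventually.of_forall hC')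
  have hi0 : Integrable (fun z => repX a b u v z * φ z) ((mI a b).prod (mI c d)) :=
    (repX_integrable hab hu hv hui hvi).mul_bdd (c := C) h.continuous.aestronglyMeasurable
      (Filter.Eventually.of_forall hC)
  rw [integral_prod_symm _ hi0, integral_prod_symm _ (hi1.fun_add hi2)]
  apply integral_congr_ae
  filter_upwards [hui.prod_left_ae, hvi.prod_left_ae] with t hut hvt
  simp only [repX]
  have hphi : Continuous fun x => φ (x, t) := by have := h.continuous; fun_prop
  have hphib : ∀ x, ‖φ (x, t)‖ ≤ C := fun x => hC _
  have hmk : Measurable fun p : ℝ × ℝ => ker a b p.1 p.2 :=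
    measurable_ker a b (by fun_prop) (by fun_prop)
  have hA1 : Integrable (fun p : ℝ × ℝ => φ (p.1, t) * (eta a b p.2 * u (p.2, t)))
      ((mI a b).prod (mI a b)) := by
    refine Integrable.bdd_mul (c := C) ?_ (hphi.comp continuous_fst).aestronglyMeasurable
      (Filter.Eventually.of_forall fun p => hphib p.1)
    exact (hut.bdd_mul (c := B) (eta_continuous a b).aestronglyMeasurable
      (Filter.Eventually.of_forall hBe)).comp_snd (mI a b)
  have hA2 : Integrable (fun p : ℝ × ℝ => (φ (p.1, t) * ker a b p.1 p.2) * v (p.2, t))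
      ((mI a b).prod (mI a b)) := by
    refine Integrable.bdd_mul (c := C * 1) (hvt.comp_snd (mI a b))
      (((hphi.comp continuous_fst).measurable.mul hmk).aestronglyMeasurable)
      (Filter.Eventually.of_forall fun p => ?_)
    rw [norm_mul]
    exact mul_le_mul (hphib p.1) (abs_ker_le _ _ _ _) (norm_nonneg _) hC0
  have hA : Integrable (Function.uncurry fun x s : ℝ =>
      φ (x, t) * (eta a b s * u (s, t)) + (φ (x, t) * ker a b x s) * v (s, t))
      ((mI a b).prod (mI a b)) := hA1.add hA2
  calc ∫ x, (∫ s, (eta a b s * u (s, t) + ker a b x s * v (s, t)) ∂(mI a b)) * φ (x, t) ∂(mI a b)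
      = ∫ x, ∫ s, (φ (x, t) * (eta a b s * u (s, t)) + (φ (x, t) * ker a b x s) * v (s, t))
          ∂(mI a b) ∂(mI a b) := by
        congr 1; ext x
        rw [← integral_mul_const]
        congr 1; ext s; ring
    _ = ∫ s, ∫ x, (φ (x, t) * (eta a b s * u (s, t)) + (φ (x, t) * ker a b x s) * v (s, t))
          ∂(mI a b) ∂(mI a b) := integral_integral_swap hA
    _ = _ := by
        congr 1; ext s
        have j1 : Integrable (fun x => φ (x, t)) (mI a b) :=
          (section_integrable h.continuous hc t).integrableOn
        have j2 : Integrable (fun x => φ (x, t) * ker a b x s) (mI a b) :=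
          j1.mul_bdd (c := 1) (measurable_ker a b measurable_id measurable_const).aestronglyMeasurable
            (Filter.Eventually.of_forall fun x => abs_ker_le _ _ _ _)
        rw [integral_add (j1.mul_const _) (j2.mul_const _), integral_mul_const, integral_mul_const,
          kerTest_eq_integral h.continuous hc hs, prim_right hs]
        simp_rw [mul_comm (φ _) (ker _ _ _ _)]
        ring

/-- Testing the weak derivative with `kerTest a b φ`, whose x-derivative is η ∫φ - φ, shows that u
and `repX a b u v` have the same integral against every φ. -/
lemma WeakX.ae_eq_repX {a b c d : ℝ} (hab : a < b) {u v : ℝ × ℝ → ℝ} (hu : Measurable u)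
    (hv : Measurable v) (hui : Integrable u ((mI a b).prod (mI c d)))
    (hvi : Integrable v ((mI a b).prod (mI c d))) (huv : WeakX a b c d u v) :
    u =ᵐ[(mI a b).prod (mI c d)] repX a b u v := by
  have hopen : IsOpen (Ioo a b ×ˢ Ioo c d : Set (ℝ × ℝ)) := isOpen_Ioo.prod isOpen_Ioo
  have hri := repX_integrable hab hu hv hui hvi
  have hint : IntegrableOn (fun z => u z - repX a b u v z) (Ioo a b ×ˢ Ioo c d) := by
    have := hui.sub hri
    rwa [prod_mI] at this
  have key := hopen.ae_eq_zero_of_integral_contDiff_smul_eq_zero hint.locallyIntegrableOn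
    (μ := volume) ?_
  · have h2 : ∀ᵐ z ∂((mI a b).prod (mI c d)), u z - repX a b u v z = 0 := by
      rw [prod_mI, ae_restrict_iff' hopen.measurableSet]
      exact key
    filter_upwards [h2] with z hz
    linarith
  · intro φ h hc hs
    have hz : ∀ z ∉ Ioo a b ×ˢ Ioo c d, φ z • (u z - repX a b u v z) = 0 := by
      intro z hz
      have : φ z = 0 := by
        by_contra hne
        exact hz (hs (subset_tsupport _ hne))
      simp [this]
    rw [← setIntegral_eq_integral_of_forall_compl_eq_zero hz, ← prod_mI]
    obtain ⟨C, hC⟩ := test_bound h.continuous hc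
    have hkt := kerTest_isTest hab h hc hs
    obtain ⟨C', hC'⟩ := test_bound hkt.1.continuous hkt.2.1
    obtain ⟨C2, hC2⟩ := test_bound (dX_smooth hkt.1).continuous (dX_compact hkt.2.1)
    have hi1 : Integrable (fun z => u z * φ z) ((mI a b).prod (mI c d)) :=
      hui.mul_bdd (c := C) h.continuous.aestronglyMeasurable (Filter.Eventually.of_forall hC)
    have hi2 : Integrable (fun z => repX a b u v z * φ z) ((mI a b).prod (mI c d)) :=
      hri.mul_bdd (c := C) h.continuous.aestronglyMeasurable (Filter.Eventually.of_forall hC)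
    have hi3 : Integrable (fun z => v z * kerTest a b φ z) ((mI a b).prod (mI c d)) :=
      hvi.mul_bdd (c := C') hkt.1.continuous.aestronglyMeasurable (Filter.Eventually.of_forall hC')
    have hi4 : Integrable (fun z => u z * dX (kerTest a b φ) z) ((mI a b).prod (mI c d)) :=
      hui.mul_bdd (c := C2) (dX_smooth hkt.1).continuous.aestronglyMeasurable
        (Filter.Eventually.of_forall hC2)
    have e1 := huv (kerTest a b φ) hkt.1 hkt.2.1 hkt.2.2
    have e2 := integral_repX_mul_test hab hu hv hui hvi h hc hs
    have e3 : ∀ z, u z * (eta a b z.1 * prim φ (b, z.2)) + v z * kerTest a b φ z =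
        u z * dX (kerTest a b φ) z + u z * φ z + v z * kerTest a b φ z := by
      intro z
      rw [dX_kerTest hab h hc hs]; ring
    simp_rw [e3] at e2
    rw [integral_add (hi4.fun_add hi1) hi3, integral_add hi4 hi1, e1] at e2
    simp_rw [smul_eq_mul, mul_sub, mul_comm (φ _)]
    rw [integral_sub hi1 hi2, e2]
    ring

lemma dX_comp_swap {φ : ℝ × ℝ → ℝ} (h : ContDiff ℝ ∞ φ) (z : ℝ × ℝ) :
    dT (fun z => φ z.swap) z = dX φ z.swap := by
  have h1 : HasFDerivAt φ (fderiv ℝ φ z.swap) z.swap :=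
    (h.differentiable (by simp) _).hasFDerivAt
  have h2 : HasFDerivAt (Prod.swap : ℝ × ℝ → ℝ × ℝ)
      ((ContinuousLinearEquiv.prodComm ℝ ℝ ℝ : ℝ × ℝ →L[ℝ] ℝ × ℝ)) z :=
    (ContinuousLinearEquiv.prodComm ℝ ℝ ℝ).hasFDerivAt
  have h3 := (h1.comp z h2).fderiv
  unfold dT dX
  change fderiv ℝ (φ ∘ Prod.swap) z (0, 1) = _
  rw [h3]
  rfl

/-- Exchanging the coordinates reduces every statement about ∂ₜ to the one about ∂ₓ. -/
lemma WeakT.swap {a b c d : ℝ} {u v : ℝ × ℝ → ℝ} (h : WeakT a b c d u v) :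
    WeakX c d a b (fun z => u z.swap) (fun z => v z.swap) := by
  intro φ hφ hc hs
  have hsw : ContDiff ℝ ∞ (fun z : ℝ × ℝ => φ z.swap) :=
    hφ.comp (contDiff_snd.prodMk contDiff_fst)
  have key := h (fun z => φ z.swap) hsw
    (hc.comp_homeomorph (Homeomorph.prodComm ℝ ℝ)) (by
      have := tsupport_comp_subset_preimage φ (f := (Prod.swap : ℝ × ℝ → ℝ × ℝ)) continuous_swap
      exact this.trans fun z hz => ⟨(hs hz).2, (hs hz).1⟩)
  have e : ∀ g : ℝ × ℝ → ℝ, ∫ z, g z ∂((mI a b).prod (mI c d)) =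
      ∫ z, g z.swap ∂((mI c d).prod (mI a b)) := fun g => (integral_prod_swap g).symm
  rw [e, e] at key
  simpa [dX_comp_swap hφ] using key

/-- The function reconstructed from `u` and its `t`-derivative `v`. -/
def repT (c d : ℝ) (u v : ℝ × ℝ → ℝ) (z : ℝ × ℝ) : ℝ :=
  ∫ r, (eta c d r * u (z.1, r) + ker c d z.2 r * v (z.1, r)) ∂(mI c d)

lemma WeakT.ae_eq_repT {a b c d : ℝ} (hcd : c < d) {u v : ℝ × ℝ → ℝ} (hu : Measurable u)
    (hv : Measurable v) (hui : Integrable u ((mI a b).prod (mI c d)))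
    (hvi : Integrable v ((mI a b).prod (mI c d))) (huv : WeakT a b c d u v) :
    u =ᵐ[(mI a b).prod (mI c d)] repT c d u v := by
  have key := huv.swap.ae_eq_repX hcd (hu.comp measurable_swap) (hv.comp measurable_swap)
    hui.swap hvi.swap
  have := Measure.measurePreserving_swap (μ := mI a b) (ν := mI c d)
    |>.quasiMeasurePreserving.ae key
  filter_upwards [this] with z hz
  simpa [repX, repT] using hz

/-- The integrand of the two-dimensional representation formula. -/
def rep4Integrand (a b c d : ℝ) (u ux ut uxt : ℝ × ℝ → ℝ) (z w : ℝ × ℝ) : ℝ :=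
  eta a b w.1 * (eta c d w.2 * u w + ker c d z.2 w.2 * ut w) +
    ker a b z.1 w.1 * (eta c d w.2 * ux w + ker c d z.2 w.2 * uxt w)

/-- The continuous function reconstructed from `u`, `uₓ`, `uₜ`, `uₓₜ`. -/
def rep4 (a b c d : ℝ) (u ux ut uxt : ℝ × ℝ → ℝ) (z : ℝ × ℝ) : ℝ :=
  ∫ w, rep4Integrand a b c d u ux ut uxt z w ∂((mI a b).prod (mI c d))

section

variable {a b c d : ℝ} {u ux ut uxt : ℝ × ℝ → ℝ}

lemma rep4Integrand_measurable (hu : Measurable u) (hux : Measurable ux) (hut : Measurable ut)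
    (huxt : Measurable uxt) (z : ℝ × ℝ) :
    Measurable (rep4Integrand a b c d u ux ut uxt z) := by
  have h1 : Measurable (eta a b) := (eta_continuous a b).measurable
  have h2 : Measurable (eta c d) := (eta_continuous c d).measurable
  have h3 : Measurable fun w : ℝ × ℝ => ker a b z.1 w.1 :=
    measurable_ker a b measurable_const measurable_fst
  have h4 : Measurable fun w : ℝ × ℝ => ker c d z.2 w.2 :=
    measurable_ker c d measurable_const measurable_snd
  unfold rep4Integrand
  fun_prop

lemma exists_rep4_bound (hab : a < b) (hcd : c < d) : ∃ K : ℝ, 0 < K ∧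
    ∀ (u ux ut uxt : ℝ × ℝ → ℝ) (z w : ℝ × ℝ), ‖rep4Integrand a b c d u ux ut uxt z w‖ ≤
      K * (|u w| + |ux w| + |ut w| + |uxt w|) := by
  obtain ⟨B, hB, hBe⟩ := eta_bound hab
  obtain ⟨B', hB', hBe'⟩ := eta_bound hcd
  -- Each of the four terms carries one factor η or `ker` per variable, bounded by B and by B'
  -- respectively.
  refine ⟨B * B', by positivity, fun u ux ut uxt z w => ?_⟩
  have hBB : 1 ≤ B * B' := one_le_mul_of_one_le_of_one_le hB hB'
  have key : ∀ p q r : ℝ, |p| ≤ B → |q| ≤ B' → |p * (q * r)| ≤ B * B' * |r| := by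
    intro p q r hp hq
    rw [abs_mul, abs_mul, ← mul_assoc]
    exact mul_le_mul_of_nonneg_right (mul_le_mul hp hq (abs_nonneg _) (by linarith)) (abs_nonneg _)
  have k1 := (abs_ker_le a b z.1 w.1).trans hB
  have k2 := (abs_ker_le c d z.2 w.2).trans hB'
  have e1 := key _ _ (u w) (hBe w.1) (hBe' w.2)
  have e2 := key _ _ (ut w) (hBe w.1) k2
  have e3 := key _ _ (ux w) k1 (hBe' w.2)
  have e4 := key _ _ (uxt w) k1 k2
  rw [Real.norm_eq_abs, rep4Integrand, mul_add, mul_add]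
  refine (abs_add_le _ _).trans ?_
  have f1 := abs_add_le (eta a b w.1 * (eta c d w.2 * u w))
    (eta a b w.1 * (ker c d z.2 w.2 * ut w))
  have f2 := abs_add_le (ker a b z.1 w.1 * (eta c d w.2 * ux w))
    (ker a b z.1 w.1 * (ker c d z.2 w.2 * uxt w))
  linarith

lemma integrable_abs_sum (hui : Integrable u ((mI a b).prod (mI c d)))
    (huxi : Integrable ux ((mI a b).prod (mI c d))) (huti : Integrable ut ((mI a b).prod (mI c d)))
    (huxti : Integrable uxt ((mI a b).prod (mI c d))) :
    Integrable (fun w => |u w| + |ux w| + |ut w| + |uxt w|) ((mI a b).prod (mI c d)) :=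
  ((hui.abs.add huxi.abs).add huti.abs).add huxti.abs

/-- Dominated convergence: for fixed z the integrand is continuous in z for every w off the null
lines w.1 = z.1 and w.2 = z.2, and the dominating function does not depend on z. -/
lemma rep4_continuous (hab : a < b) (hcd : c < d) (hu : Measurable u) (hux : Measurable ux)
    (hut : Measurable ut) (huxt : Measurable uxt) (hui : Integrable u ((mI a b).prod (mI c d)))
    (huxi : Integrable ux ((mI a b).prod (mI c d))) (huti : Integrable ut ((mI a b).prod (mI c d)))
    (huxti : Integrable uxt ((mI a b).prod (mI c d))) :
    Continuous (rep4 a b c d u ux ut uxt) := by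
  obtain ⟨K, hK, hbd⟩ := exists_rep4_bound hab hcd
  rw [continuous_iff_continuousAt]
  intro z
  refine continuousAt_of_dominated
    (bound := fun w => K * (|u w| + |ux w| + |ut w| + |uxt w|))
    (Filter.Eventually.of_forall fun y =>
      (rep4Integrand_measurable hu hux hut huxt y).aestronglyMeasurable)
    (Filter.Eventually.of_forall fun y => Filter.Eventually.of_forall fun w => hbd _ _ _ _ y w)
    ((integrable_abs_sum hui huxi huti huxti).const_mul K) ?_
  have h1 : ∀ᵐ w ∂((mI a b).prod (mI c d)), w.1 ≠ z.1 :=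
    Measure.quasiMeasurePreserving_fst.ae (Measure.ae_ne (mI a b) z.1)
  have h2 : ∀ᵐ w ∂((mI a b).prod (mI c d)), w.2 ≠ z.2 :=
    Measure.quasiMeasurePreserving_snd.ae (Measure.ae_ne (mI c d) z.2)
  filter_upwards [h1, h2] with w hw1 hw2
  have k1 : ContinuousAt (fun y : ℝ × ℝ => ker a b y.1 w.1) z :=
    ContinuousAt.comp' (f := Prod.fst) (ker_continuousAt hw1) continuousAt_fst
  have k2 : ContinuousAt (fun y : ℝ × ℝ => ker c d y.2 w.2) z :=
    ContinuousAt.comp' (f := Prod.snd) (ker_continuousAt hw2) continuousAt_snd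
  unfold rep4Integrand
  fun_prop

/-- The formula in x is applied to u; then u and ux inside the integral are replaced by their
formulas in t, which hold at almost every point of almost every horizontal line. -/
lemma rep4_ae_eq (hab : a < b) (hcd : c < d) (hu : Measurable u) (hux : Measurable ux)
    (hut : Measurable ut) (huxt : Measurable uxt) (hui : Integrable u ((mI a b).prod (mI c d)))
    (huxi : Integrable ux ((mI a b).prod (mI c d))) (huti : Integrable ut ((mI a b).prod (mI c d)))
    (huxti : Integrable uxt ((mI a b).prod (mI c d))) (h1 : WeakX a b c d u ux)
    (h2 : WeakT a b c d u ut) (h3 : WeakT a b c d ux uxt) :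
    u =ᵐ[(mI a b).prod (mI c d)] rep4 a b c d u ux ut uxt := by
  obtain ⟨K, hK, hbd⟩ := exists_rep4_bound hab hcd
  have e1 := h1.ae_eq_repX hab hu hux hui huxi
  have e2 := h2.ae_eq_repT hcd hu hut hui huti
  have e3 := h3.ae_eq_repT hcd hux huxt huxi huxti
  have sl : ∀ {f g : ℝ × ℝ → ℝ}, f =ᵐ[(mI a b).prod (mI c d)] g →
      ∀ᵐ t ∂(mI c d), ∀ᵐ s ∂(mI a b), f (s, t) = g (s, t) := by
    intro f g h
    have h' := (Measure.measurePreserving_swap (μ := mI c d) (ν := mI a b)).quasiMeasurePreserving.ae h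
    exact Measure.ae_ae_of_ae_prod h'
  filter_upwards [e1, Measure.quasiMeasurePreserving_snd.ae (sl e2),
    Measure.quasiMeasurePreserving_snd.ae (sl e3)] with z hz1 hz2 hz3
  rw [hz1, rep4, integral_prod]
  · apply integral_congr_ae
    filter_upwards [hz2, hz3, hui.prod_right_ae, huti.prod_right_ae, huxi.prod_right_ae,
      huxti.prod_right_ae] with s hs2 hs3 i1 i2 i3 i4
    obtain ⟨B', hB', hBe'⟩ := eta_bound hcd
    have me : ∀ {f : ℝ → ℝ}, Integrable f (mI c d) →
        Integrable (fun r => eta c d r * f r) (mI c d) := fun hf =>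
      hf.bdd_mul (c := B') (eta_continuous c d).aestronglyMeasurable
        (Filter.Eventually.of_forall hBe')
    have mk : ∀ {f : ℝ → ℝ}, Integrable f (mI c d) →
        Integrable (fun r => ker c d z.2 r * f r) (mI c d) := fun hf =>
      hf.bdd_mul (c := 1) (measurable_ker c d measurable_const measurable_id).aestronglyMeasurable
        (Filter.Eventually.of_forall fun r => abs_ker_le _ _ _ _)
    simp only [rep4Integrand]
    rw [integral_add (((me i1).fun_add (mk i2)).const_mul _)
      (((me i3).fun_add (mk i4)).const_mul _), integral_const_mul, integral_const_mul, hs2, hs3]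
    rfl
  · exact ((integrable_abs_sum hui huxi huti huxti).const_mul K).mono'
      (rep4Integrand_measurable hu hux hut huxt z).aestronglyMeasurable
      (Filter.Eventually.of_forall fun w => hbd _ _ _ _ z w)

lemma repX_continuous (hab : a < b) {f g : ℝ × ℝ → ℝ} (hf : Continuous f) (hg : Continuous g)
    {C : ℝ} (hfb : ∀ z, |f z| ≤ C) (hgb : ∀ z, |g z| ≤ C) : Continuous (repX a b f g) := by
  obtain ⟨B, hB, hBe⟩ := eta_bound hab
  have hC : 0 ≤ C := (abs_nonneg _).trans (hfb 0)
  rw [continuous_iff_continuousAt]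
  intro z
  have hm : ∀ y : ℝ × ℝ, Measurable fun s => eta a b s * f (s, y.2) + ker a b y.1 s * g (s, y.2) :=
    fun y => by
      have h1 : Measurable (eta a b) := (eta_continuous a b).measurable
      have h3 : Measurable fun s => ker a b y.1 s := measurable_ker a b measurable_const measurable_id
      have := hf.measurable
      have := hg.measurable
      fun_prop
  refine continuousAt_of_dominated (bound := fun _ => B * C + C)
    (Filter.Eventually.of_forall fun y => (hm y).aestronglyMeasurable)
    (Filter.Eventually.of_forall fun y => Filter.Eventually.of_forall fun s => ?_)
    (integrable_const _) ?_
  · rw [Real.norm_eq_abs]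
    refine (abs_add_le _ _).trans (add_le_add ?_ ?_)
    · rw [abs_mul]
      exact mul_le_mul (hBe s) (hfb _) (abs_nonneg _) (by linarith)
    · rw [abs_mul]
      calc _ ≤ 1 * C := mul_le_mul (abs_ker_le _ _ _ _) (hgb _) (abs_nonneg _) zero_le_one
        _ = C := one_mul C
  · filter_upwards [Measure.ae_ne (mI a b) z.1] with s hs
    have k1 : ContinuousAt (fun y : ℝ × ℝ => ker a b y.1 s) z :=
      ContinuousAt.comp' (f := Prod.fst) (ker_continuousAt hs) continuousAt_fst
    fun_prop

/-- This makes boundary values well defined: a continuous representative is determined on the closed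
rectangle by its class in the open one. -/
lemma eqOn_closedRect_of_ae_eq (hab : a < b) (hcd : c < d) {f g : ℝ × ℝ → ℝ}
    (hf : ContinuousOn f (Icc a b ×ˢ Icc c d)) (hg : ContinuousOn g (Icc a b ×ˢ Icc c d))
    (h : f =ᵐ[(volume : Measure (ℝ × ℝ)).restrict (Ioo a b ×ˢ Ioo c d)] g) :
    EqOn f g (Icc a b ×ˢ Icc c d) := by
  have hsub : Ioo a b ×ˢ Ioo c d ⊆ Icc a b ×ˢ Icc c d :=
    prod_mono Ioo_subset_Icc_self Ioo_subset_Icc_self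
  have h1 := Measure.eqOn_open_of_ae_eq h (isOpen_Ioo.prod isOpen_Ioo) (hf.mono hsub)
    (hg.mono hsub)
  refine h1.of_subset_closure hf hg hsub ?_
  rw [closure_prod_eq, closure_Ioo hab.ne, closure_Ioo hcd.ne]

lemma WeakX.congr {f g : ℝ × ℝ → ℝ} (h : WeakX a b c d u ux)
    (hf : u =ᵐ[(mI a b).prod (mI c d)] f) (hg : ux =ᵐ[(mI a b).prod (mI c d)] g) :
    WeakX a b c d f g := by
  intro φ h1 h2 h3
  have e1 : ∫ z, f z * dX φ z ∂((mI a b).prod (mI c d)) =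
      ∫ z, u z * dX φ z ∂((mI a b).prod (mI c d)) :=
    integral_congr_ae (by filter_upwards [hf] with z hz; rw [hz])
  have e2 : ∫ z, g z * φ z ∂((mI a b).prod (mI c d)) =
      ∫ z, ux z * φ z ∂((mI a b).prod (mI c d)) :=
    integral_congr_ae (by filter_upwards [hg] with z hz; rw [hz])
  rw [e1, e2, h φ h1 h2 h3]

lemma WeakT.congr {f g : ℝ × ℝ → ℝ} (h : WeakT a b c d u ut)
    (hf : u =ᵐ[(mI a b).prod (mI c d)] f) (hg : ut =ᵐ[(mI a b).prod (mI c d)] g) :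
    WeakT a b c d f g := by
  intro φ h1 h2 h3
  have e1 : ∫ z, f z * dT φ z ∂((mI a b).prod (mI c d)) =
      ∫ z, u z * dT φ z ∂((mI a b).prod (mI c d)) :=
    integral_congr_ae (by filter_upwards [hf] with z hz; rw [hz])
  have e2 : ∫ z, g z * φ z ∂((mI a b).prod (mI c d)) =
      ∫ z, ut z * φ z ∂((mI a b).prod (mI c d)) :=
    integral_congr_ae (by filter_upwards [hg] with z hz; rw [hz])
  rw [e1, e2, h φ h1 h2 h3]

lemma continuous_bdd_integrable {f : ℝ × ℝ → ℝ} (hf : Continuous f) {C : ℝ}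
    (hfb : ∀ z, |f z| ≤ C) : Integrable f ((mI a b).prod (mI c d)) :=
  (integrable_const C).mono' hf.aestronglyMeasurable (Filter.Eventually.of_forall hfb)

/-- The fundamental theorem of calculus in `x` for continuous functions with a continuous weak
derivative. -/
lemma WeakX.eq_add_integral (hab : a < b) (hcd : c < d) {f g : ℝ × ℝ → ℝ} (hf : Continuous f)
    (hg : Continuous g) {C : ℝ} (hfb : ∀ z, |f z| ≤ C) (hgb : ∀ z, |g z| ≤ C)
    (h : WeakX a b c d f g) {x t : ℝ} (hx : x ∈ Icc a b) (ht : t ∈ Icc c d) :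
    f (x, t) = f (a, t) + ∫ s in a..x, g (s, t) := by
  have e := h.ae_eq_repX hab hf.measurable hg.measurable (continuous_bdd_integrable hf hfb)
    (continuous_bdd_integrable hg hgb)
  rw [prod_mI] at e
  have e2 := eqOn_closedRect_of_ae_eq hab hcd hf.continuousOn
    (repX_continuous hab hf hg hfb hgb).continuousOn e
  have ex : f (x, t) = _ := e2 ⟨hx, ht⟩
  have ea : f (a, t) = _ := e2 ⟨left_mem_Icc.2 hab.le, ht⟩
  have hgt : Continuous fun s => g (s, t) := by fun_prop
  have hft : Continuous fun s => f (s, t) := by fun_prop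
  have hgi : Integrable (fun s => g (s, t)) (mI a b) :=
    (hgt.integrableOn_Icc (a := a) (b := b)).mono_set Ioo_subset_Icc_self
  have hfi : Integrable (fun s => f (s, t)) (mI a b) :=
    (hft.integrableOn_Icc (a := a) (b := b)).mono_set Ioo_subset_Icc_self
  obtain ⟨B, hB, hBe⟩ := eta_bound hab
  have i1 : Integrable (fun s => eta a b s * f (s, t)) (mI a b) :=
    hfi.bdd_mul (c := B) (eta_continuous a b).aestronglyMeasurable (Filter.Eventually.of_forall hBe)
  have i2 : ∀ y, Integrable (fun s => ker a b y s * g (s, t)) (mI a b) := fun y =>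
    hgi.bdd_mul (c := 1) (measurable_ker a b measurable_const measurable_id).aestronglyMeasurable
      (Filter.Eventually.of_forall fun r => abs_ker_le _ _ _ _)
  have key : f (x, t) - f (a, t) = ∫ s in a..x, g (s, t) := by
    rw [ex, ea, repX, repX, ← integral_sub (i1.fun_add (i2 x)) (i1.fun_add (i2 a)),
      intervalIntegral.integral_of_le hx.1, integral_Ioc_eq_integral_Ioo]
    -- The η terms do not depend on x and cancel; the kernels at x and at a differ by the indicator
    -- of [a, x).
    have : ∀ s, eta a b s * f (s, t) + ker a b x s * g (s, t) -
        (eta a b s * f (s, t) + ker a b a s * g (s, t)) =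
        ((Ici a).indicator 1 s - (Ici x).indicator 1 s) * g (s, t) := by
      intro s; simp only [ker]; ring
    simp only [this, ← integral_Ico_eq_integral_Ioo]
    have e3 : ∀ s ∈ Ico a b, ((Ici a).indicator 1 s - (Ici x).indicator 1 s) * g (s, t) =
        (Ico a x).indicator (fun s => g (s, t)) s := by
      intro s hs
      have h1 : a ≤ s := hs.1
      by_cases hxs : x ≤ s
      · simp [indicator, h1, hxs]
      · simp [indicator, h1, not_le.1 hxs, hxs]
    rw [setIntegral_congr_fun measurableSet_Ico e3, setIntegral_indicator measurableSet_Ico]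
    congr 2
    ext s
    simp only [mem_inter_iff, mem_Ico]
    constructor
    · exact fun h => h.2
    · exact fun h => ⟨⟨h.1, h.2.trans_le hx.2⟩, h⟩
  linarith

/-- The fundamental theorem of calculus in `t` for continuous functions with a continuous weak
derivative. -/
lemma WeakT.eq_add_integral (hab : a < b) (hcd : c < d) {f g : ℝ × ℝ → ℝ} (hf : Continuous f)
    (hg : Continuous g) {C : ℝ} (hfb : ∀ z, |f z| ≤ C) (hgb : ∀ z, |g z| ≤ C)
    (h : WeakT a b c d f g) {x t : ℝ} (hx : x ∈ Icc a b) (ht : t ∈ Icc c d) :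
    f (x, t) = f (x, c) + ∫ r in c..t, g (x, r) :=
  h.swap.eq_add_integral hcd hab (hf.comp continuous_swap) (hg.comp continuous_swap)
    (fun _ => hfb _) (fun _ => hgb _) ht hx

end

/-! ### Embedding of H⁴ into classical functions, and completeness. -/

lemma muOm_eq_prod (ε b T : ℝ) : muOm ε b T = (mI ε b).prod (mI 0 T) := (prod_mI ε b 0 T).symm

lemma ae_eq_muOm_iff {ε b T : ℝ} {f g : ℝ × ℝ → ℝ} :
    f =ᵐ[muOm ε b T] g ↔ f =ᵐ[(mI ε b).prod (mI 0 T)] g := by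
  rw [muOm_eq_prod]

instance muOm_finite (ε b T : ℝ) : IsFiniteMeasure (muOm ε b T) := by
  rw [muOm_eq_prod]; infer_instance

lemma dX_dT_comm {φ : ℝ × ℝ → ℝ} (h : ContDiff ℝ ∞ φ) : dT (dX φ) = dX (dT φ) := by
  have h1 : Differentiable ℝ (fderiv ℝ φ) :=
    (h.fderiv_right (m := ∞) (by simp)).differentiable (by simp)
  have key : ∀ z v w : ℝ × ℝ, fderiv ℝ (fun y => fderiv ℝ φ y v) z w =
      fderiv ℝ (fderiv ℝ φ) z w v := by
    intro z v w
    rw [fderiv_clm_apply (h1 z) (differentiableAt_const v)]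
    simp
  ext z
  have hs : IsSymmSndFDerivAt ℝ φ z := (contDiff_infty.1 h 2).contDiffAt.isSymmSndFDerivAt (by simp)
  unfold dT dX
  rw [key, key]
  exact hs _ _

lemma iterate_dT_smooth {φ : ℝ × ℝ → ℝ} (h : ContDiff ℝ ∞ φ) (j : ℕ) :
    ContDiff ℝ ∞ (dT^[j] φ) := by
  induction j with
  | zero => exact h
  | succ k ih =>
    rw [Function.iterate_succ_apply']
    exact dT_smooth ih

lemma iterate_dT_dX {φ : ℝ × ℝ → ℝ} (h : ContDiff ℝ ∞ φ) (j : ℕ) :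
    dT^[j] (dX φ) = dX (dT^[j] φ) := by
  induction j with
  | zero => rfl
  | succ k ih =>
    rw [Function.iterate_succ_apply', Function.iterate_succ_apply', ih,
      dX_dT_comm (iterate_dT_smooth h k)]

lemma isTest_dX {ε b T : ℝ} {φ : ℝ × ℝ → ℝ} (h : IsTest ε b T φ) : IsTest ε b T (dX φ) := by
  refine ⟨dX_smooth h.1, dX_compact h.2.1, Subset.trans ?_ h.2.2⟩
  refine closure_minimal (fun z hz => ?_) (isClosed_tsupport φ)
  by_contra hne
  exact hz (by simp [dX, fderiv_of_notMem_tsupport ℝ hne])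

lemma isTest_dT {ε b T : ℝ} {φ : ℝ × ℝ → ℝ} (h : IsTest ε b T φ) : IsTest ε b T (dT φ) := by
  refine ⟨dT_smooth h.1, dT_compact h.2.1, Subset.trans ?_ h.2.2⟩
  refine closure_minimal (fun z hz => ?_) (isClosed_tsupport φ)
  by_contra hne
  exact hz (by simp [dT, fderiv_of_notMem_tsupport ℝ hne])

section

variable {ε b T : ℝ}

lemma H4.isWeakDeriv (u : H4 ε b T) (i j : Fin 5) (h : (i : ℕ) + (j : ℕ) ≤ 4) :
    IsWeakDeriv ε b T i j (u.D 0 0) (u.D i j h) :=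
  u.2 ⟨(i, j), h⟩

/-- `IsWeakDeriv` relates each derivative only to u itself; comparing the order j + 1 tested with φ
and the order j tested with `dT φ` links consecutive derivatives directly. -/
lemma H4.weakT (u : H4 ε b T) {i j j' : Fin 5} (h : (i : ℕ) + (j : ℕ) ≤ 4)
    (h' : (i : ℕ) + (j' : ℕ) ≤ 4) (hj : (j' : ℕ) = j + 1) :
    WeakT ε b 0 T (u.D i j h) (u.D i j' h') := by
  intro φ h1 h2 h3
  rw [← muOm_eq_prod]
  have e1 := u.isWeakDeriv i j h (dT φ) (isTest_dT ⟨h1, h2, h3⟩)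
  have e2 := u.isWeakDeriv i j' h' φ ⟨h1, h2, h3⟩
  rw [hj, Function.iterate_succ_apply, e1, ← add_assoc, pow_succ] at e2
  have hne : ((-1 : ℝ) ^ ((i : ℕ) + (j : ℕ))) ≠ 0 := by simp
  apply mul_left_cancel₀ hne
  rw [e2]; ring

lemma H4.weakX (u : H4 ε b T) {i i' j : Fin 5} (h : (i : ℕ) + (j : ℕ) ≤ 4)
    (h' : (i' : ℕ) + (j : ℕ) ≤ 4) (hi : (i' : ℕ) = i + 1) :
    WeakX ε b 0 T (u.D i j h) (u.D i' j h') := by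
  intro φ h1 h2 h3
  rw [← muOm_eq_prod]
  have e1 := u.isWeakDeriv i j h (dX φ) (isTest_dX ⟨h1, h2, h3⟩)
  have e2 := u.isWeakDeriv i' j h' φ ⟨h1, h2, h3⟩
  rw [iterate_dT_dX h1] at e1
  rw [hi, Function.iterate_succ_apply, e1, add_right_comm, pow_succ] at e2
  have hne : ((-1 : ℝ) ^ ((i : ℕ) + (j : ℕ))) ≠ 0 := by simp
  apply mul_left_cancel₀ hne
  rw [e2]; ring

lemma H4.norm_D_le (u : H4 ε b T) (i j : Fin 5) (h : (i : ℕ) + (j : ℕ) ≤ 4) :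
    ‖u.D i j h‖ ≤ ‖u‖ :=
  PiLp.norm_apply_le (p := 2) (β := fun _ : Idx => L2 ε b T) u.1 ⟨(i, j), h⟩

lemma L2_norm_sq (g : L2 ε b T) : ‖g‖ ^ 2 = ∫ z, g z ^ 2 ∂(muOm ε b T) := by
  rw [← real_inner_self_eq_norm_sq, L2.inner_def]
  congr 1; ext z
  simp [sq]

lemma L2_integrable_sq (g : L2 ε b T) : Integrable (fun z => g z ^ 2) (muOm ε b T) :=
  (Lp.memLp g).integrable_sq

lemma L2_integrable (g : L2 ε b T) : Integrable g (muOm ε b T) :=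
  (Lp.memLp g).integrable (by norm_num)

/-- Integrate |g| ≤ g²/N + N with N = ‖g‖; the constant is not the sharp one. -/
lemma integral_abs_le (g : L2 ε b T) :
    ∫ z, |g z| ∂(muOm ε b T) ≤ (1 + (muOm ε b T).real univ) * ‖g‖ := by
  rcases (norm_nonneg g).eq_or_lt with h0 | h0
  · have hg : g = 0 := norm_eq_zero.1 h0.symm
    have : ∫ z, |g z| ∂(muOm ε b T) = 0 := by
      apply integral_eq_zero_of_ae
      filter_upwards [Lp.coeFn_zero ℝ 2 (muOm ε b T)] with z hz
      rw [hg, hz]; simp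
    rw [this, ← h0]; simp
  · set N := ‖g‖ with hN
    have h1 : ∫ z, |g z| ∂(muOm ε b T) ≤ ∫ z, (N⁻¹ * g z ^ 2 + N) ∂(muOm ε b T) := by
      refine integral_mono (L2_integrable g).abs
        (((L2_integrable_sq g).const_mul _).add (integrable_const N)) fun z => ?_
      have h2 : 0 ≤ N⁻¹ * (|g z| - N) ^ 2 + |g z| := by positivity
      have h3 : N⁻¹ * (|g z| - N) ^ 2 = N⁻¹ * g z ^ 2 - 2 * |g z| + N := by
        rw [← sq_abs (g z)]; field_simp; ring
      simp only
      linarith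
    rw [integral_add ((L2_integrable_sq g).const_mul _) (integrable_const N), integral_const_mul,
      ← L2_norm_sq, ← hN] at h1
    have h4 : N⁻¹ * N ^ 2 = N := by field_simp
    rw [h4] at h1
    simpa [mul_add, mul_comm] using h1

/-- Weak derivatives of order at most `2` of a function in `H⁴(Ω)` have bounded continuous
representatives. -/
lemma exists_continuous_rep (hεb : ε < b) (hT : 0 < T) : ∃ C : ℝ, 0 < C ∧
    ∀ (u : H4 ε b T) (i j : Fin 5) (h : (i : ℕ) + (j : ℕ) ≤ 2), ∃ f : ℝ × ℝ → ℝ, Continuous f ∧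
      (u.D i j (by omega)) =ᵐ[muOm ε b T] f ∧ ∀ z, |f z| ≤ C * ‖u‖ := by
  obtain ⟨K, hK, hbd⟩ := exists_rep4_bound hεb hT
  set V := 1 + (muOm ε b T).real univ with hV
  have hVpos : 0 < V := by positivity
  refine ⟨K * (4 * V), by positivity, fun u i j h => ?_⟩
  -- The mixed derivative of order (i + 1, j + 1) still has total order at most 4, because i + j ≤
  -- 2.
  let i' : Fin 5 := ⟨i + 1, by omega⟩
  let j' : Fin 5 := ⟨j + 1, by omega⟩
  set U := u.D i j (by omega)
  set Ux := u.D i' j (by simp only [i']; omega)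
  set Ut := u.D i j' (by simp only [j']; omega)
  set Uxt := u.D i' j' (by simp only [i', j']; omega)
  have hm : ∀ g : L2 ε b T, Measurable g := fun g => (Lp.stronglyMeasurable g).measurable
  have hi : ∀ g : L2 ε b T, Integrable g ((mI ε b).prod (mI 0 T)) := fun g => by
    rw [← muOm_eq_prod]; exact L2_integrable g
  have w1 : WeakX ε b 0 T U Ux := u.weakX _ _ rfl
  have w2 : WeakT ε b 0 T U Ut := u.weakT _ _ rfl
  have w3 : WeakT ε b 0 T Ux Uxt := u.weakT _ _ rfl
  refine ⟨rep4 ε b 0 T U Ux Ut Uxt, rep4_continuous hεb hT (hm _) (hm _) (hm _) (hm _) (hi _)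
    (hi _) (hi _) (hi _), ?_, fun z => ?_⟩
  · rw [ae_eq_muOm_iff]
    exact rep4_ae_eq hεb hT (hm _) (hm _) (hm _) (hm _) (hi _) (hi _) (hi _) (hi _) w1 w2 w3
  · have hint := (integrable_abs_sum (hi U) (hi Ux) (hi Ut) (hi Uxt)).const_mul K
    have h1 := norm_integral_le_of_norm_le hint
      (Filter.Eventually.of_forall fun w => hbd U Ux Ut Uxt z w)
    rw [← rep4, Real.norm_eq_abs] at h1
    refine h1.trans ?_
    rw [← muOm_eq_prod, integral_const_mul,
      integral_add (((L2_integrable _).abs.fun_add (L2_integrable _).abs).fun_add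
        (L2_integrable _).abs) (L2_integrable _).abs,
      integral_add ((L2_integrable _).abs.fun_add (L2_integrable _).abs) (L2_integrable _).abs,
      integral_add (L2_integrable _).abs (L2_integrable _).abs, mul_assoc]
    refine mul_le_mul_of_nonneg_left ?_ hK.le
    have b0 : ∀ g : L2 ε b T, ‖g‖ ≤ ‖u‖ → ∫ z, |g z| ∂(muOm ε b T) ≤ V * ‖u‖ := fun g hg =>
      (integral_abs_le g).trans (mul_le_mul_of_nonneg_left hg hVpos.le)
    have b1 := b0 U (u.norm_D_le _ _ _)
    have b2 := b0 Ux (u.norm_D_le _ _ _)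
    have b3 := b0 Ut (u.norm_D_le _ _ _)
    have b4 := b0 Uxt (u.norm_D_le _ _ _)
    linarith

/-- Continuous representatives of `u`, `uₓ`, `uₜ`, `uₓₓ`, `uₓₜ`, bounded by `B`, which are classical
derivatives of each other. -/
structure ClassicalRep (u : H4 ε b T) (B : ℝ) (f fx ft fxx fxt : ℝ × ℝ → ℝ) : Prop where
  cont_f : Continuous f
  cont_fx : Continuous fx
  cont_ft : Continuous ft
  cont_fxx : Continuous fxx
  cont_fxt : Continuous fxt
  ae_f : u.D 0 0 =ᵐ[muOm ε b T] f
  ae_fx : u.D 1 0 =ᵐ[muOm ε b T] fx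
  ae_ft : u.D 0 1 =ᵐ[muOm ε b T] ft
  ae_fxx : u.D 2 0 =ᵐ[muOm ε b T] fxx
  ae_fxt : u.D 1 1 =ᵐ[muOm ε b T] fxt
  bound_fx : ∀ z, |fx z| ≤ B
  f_x : ∀ x ∈ Icc ε b, ∀ t ∈ Icc 0 T, f (x, t) = f (ε, t) + ∫ s in ε..x, fx (s, t)
  f_t : ∀ x ∈ Icc ε b, ∀ t ∈ Icc 0 T, f (x, t) = f (x, 0) + ∫ r in 0..t, ft (x, r)
  fx_x : ∀ x ∈ Icc ε b, ∀ t ∈ Icc 0 T, fx (x, t) = fx (ε, t) + ∫ s in ε..x, fxx (s, t)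
  fx_t : ∀ x ∈ Icc ε b, ∀ t ∈ Icc 0 T, fx (x, t) = fx (x, 0) + ∫ r in 0..t, fxt (x, r)
  ft_x : ∀ x ∈ Icc ε b, ∀ t ∈ Icc 0 T, ft (x, t) = ft (ε, t) + ∫ s in ε..x, fxt (s, t)

lemma exists_classicalRep (hεb : ε < b) (hT : 0 < T) : ∃ C : ℝ, 0 < C ∧
    ∀ u : H4 ε b T, ∃ f fx ft fxx fxt, ClassicalRep u (C * ‖u‖) f fx ft fxx fxt := by
  obtain ⟨C, hC, hrep⟩ := exists_continuous_rep hεb hT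
  refine ⟨C, hC, fun u => ?_⟩
  obtain ⟨f, c1, a1, b1⟩ := hrep u 0 0 (by decide)
  obtain ⟨fx, c2, a2, b2⟩ := hrep u 1 0 (by decide)
  obtain ⟨ft, c3, a3, b3⟩ := hrep u 0 1 (by decide)
  obtain ⟨fxx, c4, a4, b4⟩ := hrep u 2 0 (by decide)
  obtain ⟨fxt, c5, a5, b5⟩ := hrep u 1 1 (by decide)
  refine ⟨f, fx, ft, fxx, fxt, c1, c2, c3, c4, c5, a1, a2, a3, a4, a5, b2, ?_, ?_, ?_, ?_, ?_⟩
  all_goals rw [ae_eq_muOm_iff] at a1 a2 a3 a4 a5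
  all_goals intro x hx t ht
  · exact ((u.weakX (by decide) (by decide) rfl).congr a1 a2).eq_add_integral hεb hT c1 c2 b1 b2 hx ht
  · exact ((u.weakT (by decide) (by decide) rfl).congr a1 a3).eq_add_integral hεb hT c1 c3 b1 b3 hx ht
  · exact ((u.weakX (by decide) (by decide) rfl).congr a2 a4).eq_add_integral hεb hT c2 c4 b2 b4 hx ht
  · exact ((u.weakT (by decide) (by decide) rfl).congr a2 a5).eq_add_integral hεb hT c2 c5 b2 b5 hx ht
  · exact ((u.weakX (by decide) (by decide) rfl).congr a3 a5).eq_add_integral hεb hT c3 c5 b3 b5 hx ht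

lemma IsContRep.eqOn (hεb : ε < b) (hT : 0 < T) {u : L2 ε b T} {f g : ℝ × ℝ → ℝ}
    (hf : IsContRep ε b T u f) (hg : IsContRep ε b T u g) : EqOn f g (OmBar ε b T) :=
  eqOn_closedRect_of_ae_eq hεb hT hf.1 hg.1 (hf.2.symm.trans hg.2)

lemma IsContRep.contRep {u : L2 ε b T} {f : ℝ × ℝ → ℝ} (hf : IsContRep ε b T u f) :
    IsContRep ε b T u (contRep u) := by
  have h : ∃ f, IsContRep ε b T u f := ⟨f, hf⟩
  rw [Carleman1D.contRep, dif_pos h]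
  exact h.choose_spec

lemma IsContRep.contRep_eqOn (hεb : ε < b) (hT : 0 < T) {u : L2 ε b T} {f : ℝ × ℝ → ℝ}
    (hf : IsContRep ε b T u f) : EqOn (Carleman1D.contRep u) f (OmBar ε b T) :=
  hf.contRep.eqOn hεb hT hf

/-- Point values on the closed rectangle are continuous linear functionals on `H⁴(Ω)`. -/
lemma exists_eval (hεb : ε < b) (hT : 0 < T) (i j : Fin 5) (h : (i : ℕ) + (j : ℕ) ≤ 2)
    {z : ℝ × ℝ} (hz : z ∈ OmBar ε b T) : ∃ L : H4 ε b T →L[ℝ] ℝ,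
      ∀ u : H4 ε b T, L u = contRep (u.D i j (by omega)) z := by
  obtain ⟨C, hC, hrep⟩ := exists_continuous_rep hεb hT
  choose f hc ha hb using fun u => hrep u i j h
  have hcr : ∀ u : H4 ε b T, IsContRep ε b T (u.D i j (by omega)) (f u) := fun u =>
    ⟨(hc u).continuousOn, ha u⟩
  -- `contRep` is defined by choice, yet on the closed rectangle it agrees with any continuous
  -- representative; linearity and the bound come from this.
  have hval : ∀ u : H4 ε b T, contRep (u.D i j (by omega)) z = f u z := fun u =>
    (hcr u).contRep_eqOn hεb hT hz
  refine ⟨LinearMap.mkContinuous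
    { toFun := fun u => contRep (u.D i j (by omega)) z
      map_add' := fun u v => ?_
      map_smul' := fun c u => ?_ } C fun u => ?_, fun u => rfl⟩
  · rw [hval u, hval v]
    exact (contRep_add (hcr u) (hcr v)).contRep_eqOn hεb hT hz
  · rw [hval u]
    exact (contRep_smul c (hcr u)).contRep_eqOn hεb hT hz
  · change |contRep (u.D i j (by omega)) z| ≤ _
    rw [hval u]
    exact hb u z

lemma continuous_integral_mul {ψ : ℝ × ℝ → ℝ} (h : ContDiff ℝ ∞ ψ) (hc : HasCompactSupport ψ) :
    Continuous fun g : L2 ε b T => ∫ z, g z * ψ z ∂(muOm ε b T) := by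
  have hm : MemLp ψ 2 (muOm ε b T) := h.continuous.memLp_of_hasCompactSupport hc
  have e : (fun g : L2 ε b T => ∫ z, g z * ψ z ∂(muOm ε b T)) =
      fun g => inner ℝ (hm.toLp ψ) g := by
    ext g
    rw [L2.inner_def]
    apply integral_congr_ae
    filter_upwards [hm.coeFn_toLp] with z hz
    rw [hz]; simp
  rw [e]
  fun_prop

/-- Each weak derivative identity is a closed condition, since pairing with a test function is
continuous on L². Completeness of H⁴ follows. -/
lemma isClosed_H4Sub : IsClosed (H4Sub ε b T : Set (PiLp 2 fun _ : Idx => L2 ε b T)) := by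
  have : (H4Sub ε b T : Set (PiLp 2 fun _ : Idx => L2 ε b T)) =
      ⋂ (k : Idx) (φ : {φ : ℝ × ℝ → ℝ // IsTest ε b T φ}),
        {U | ∫ z, (U idx0) z * (dX^[(k.1.1 : ℕ)] (dT^[(k.1.2 : ℕ)] φ.1)) z ∂(muOm ε b T)
          = (-1) ^ ((k.1.1 : ℕ) + (k.1.2 : ℕ)) * ∫ z, (U k) z * φ.1 z ∂(muOm ε b T)} := by
    ext U
    simp only [mem_iInter, mem_ofPred_eq]
    exact ⟨fun h k φ => h k φ.1 φ.2, fun h k φ hφ => h k ⟨φ, hφ⟩⟩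
  rw [this]
  refine isClosed_iInter fun k => isClosed_iInter fun φ => isClosed_eq ?_ ?_
  · obtain ⟨g1, g2⟩ := iter_good φ.2.1 φ.2.2.1 (k.1.1 : ℕ) (k.1.2 : ℕ)
    exact (continuous_integral_mul g1 g2).comp (PiLp.continuous_apply 2 _ idx0)
  · exact continuous_const.mul
      ((continuous_integral_mul φ.2.1 φ.2.2.1).comp (PiLp.continuous_apply 2 _ k))

instance H4_complete : CompleteSpace (H4 ε b T) :=
  (isClosed_H4Sub (ε := ε) (b := b) (T := T)).completeSpace_coe

end

/-! ### Boundary conditions and the admissible set. -/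

section

variable {ε b T : ℝ}

lemma H4.isContRep_contRep (hεb : ε < b) (hT : 0 < T) (u : H4 ε b T) (i j : Fin 5)
    (h : (i : ℕ) + (j : ℕ) ≤ 2) :
    IsContRep ε b T (u.D i j (by omega)) (contRep (u.D i j (by omega))) := by
  obtain ⟨C, hC, hrep⟩ := exists_continuous_rep hεb hT
  obtain ⟨f, h1, h2, h3⟩ := hrep u i j h
  exact IsContRep.contRep ⟨h1.continuousOn, h2⟩

lemma mem_OmBar_left (hεb : ε < b) {t : ℝ} (ht : t ∈ Ioo 0 T) : (ε, t) ∈ OmBar ε b T :=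
  ⟨left_mem_Icc.2 hεb.le, Ioo_subset_Icc_self ht⟩

lemma mem_OmBar_right (hεb : ε < b) {t : ℝ} (ht : t ∈ Ioo 0 T) : (b, t) ∈ OmBar ε b T :=
  ⟨right_mem_Icc.2 hεb.le, Ioo_subset_Icc_self ht⟩

lemma mem_OmBar_bottom (hT : 0 < T) {x : ℝ} (hx : x ∈ Icc ε b) : (x, 0) ∈ OmBar ε b T :=
  ⟨hx, left_mem_Icc.2 hT.le⟩

/-- The lateral boundary conditions with data `p`, `r` on `x = ε`, and `uₓ = 0` on `x = b`. -/
def lateralSet (ε b T : ℝ) (p r : ℝ → ℝ) : Set (H4 ε b T) :=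
  {v | ∀ t ∈ Ioo 0 T, contRep (v.D 0 0) (ε, t) = p t ∧ contRep (v.D 1 0) (ε, t) = r t ∧
    contRep (v.D 1 0) (b, t) = 0}

lemma lateralSet_iff (hεb : ε < b) (hT : 0 < T) {p r : ℝ → ℝ} {v : H4 ε b T} {f fx : ℝ × ℝ → ℝ}
    (hf : IsContRep ε b T (v.D 0 0) f) (hfx : IsContRep ε b T (v.D 1 0) fx) :
    v ∈ lateralSet ε b T p r ↔
      ∀ t ∈ Ioo 0 T, f (ε, t) = p t ∧ fx (ε, t) = r t ∧ fx (b, t) = 0 := by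
  refine forall₂_congr fun t ht => ?_
  rw [hf.contRep_eqOn hεb hT (mem_OmBar_left hεb ht),
    hfx.contRep_eqOn hεb hT (mem_OmBar_left hεb ht),
    hfx.contRep_eqOn hεb hT (mem_OmBar_right hεb ht)]

/-- The conditions are level sets of the continuous point evaluations of `exists_eval`. -/
lemma isClosed_lateralSet (hεb : ε < b) (hT : 0 < T) (p r : ℝ → ℝ) :
    IsClosed (lateralSet ε b T p r) := by
  have : lateralSet ε b T p r = ⋂ t ∈ Ioo 0 T, ({v | contRep (v.D 0 0) (ε, t) = p t} ∩
      ({v | contRep (v.D 1 0) (ε, t) = r t} ∩ {v | contRep (v.D 1 0) (b, t) = 0})) := by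
    ext v
    simp only [lateralSet, mem_iInter, mem_inter_iff, mem_ofPred_eq]
  rw [this]
  have key : ∀ (i j : Fin 5) (h : (i : ℕ) + (j : ℕ) ≤ 2) (z : ℝ × ℝ), z ∈ OmBar ε b T → ∀ y : ℝ,
      IsClosed {v : H4 ε b T | contRep (v.D i j (by omega)) z = y} := by
    intro i j h z hz y
    obtain ⟨L, hL⟩ := exists_eval hεb hT i j h hz
    simp_rw [← hL]
    exact isClosed_eq L.continuous continuous_const
  refine isClosed_biInter fun t ht => (key 0 0 (by decide) _ (mem_OmBar_left hεb ht) _).inter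
    ((key 1 0 (by decide) _ (mem_OmBar_left hεb ht) _).inter
      (key 1 0 (by decide) _ (mem_OmBar_right hεb ht) _))

lemma H40_eq_lateralSet (hεb : ε < b) (hT : 0 < T) :
    (H40 ε b T : Set (H4 ε b T)) = lateralSet ε b T 0 0 := by
  ext v
  constructor
  · rintro ⟨f, fx, h1, h2, h3⟩
    exact (lateralSet_iff hεb hT h1 h2).2 h3
  · intro hv
    exact ⟨_, _, v.isContRep_contRep hεb hT 0 0 (by decide),
      v.isContRep_contRep hεb hT 1 0 (by decide), hv⟩

lemma H40_complete (hεb : ε < b) (hT : 0 < T) : CompleteSpace (H40 ε b T) := by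
  have : IsClosed (H40 ε b T : Set (H4 ε b T)) := by
    rw [H40_eq_lateralSet hεb hT]
    exact isClosed_lateralSet hεb hT 0 0
  exact this.completeSpace_coe

lemma lateralSet_sub (hεb : ε < b) (hT : 0 < T) {p r : ℝ → ℝ} {u v : H4 ε b T}
    (hu : u ∈ lateralSet ε b T p r) (hv : v ∈ lateralSet ε b T p r) : u - v ∈ H40 ε b T := by
  have hu1 := u.isContRep_contRep hεb hT 0 0 (by decide)
  have hu2 := u.isContRep_contRep hεb hT 1 0 (by decide)
  have hv1 := v.isContRep_contRep hεb hT 0 0 (by decide)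
  have hv2 := v.isContRep_contRep hεb hT 1 0 (by decide)
  have e : u - v = u + (-1 : ℝ) • v := by rw [neg_one_smul, sub_eq_add_neg]
  rw [e]
  refine ⟨_, _, contRep_add hu1 (contRep_smul (-1) hv1), contRep_add hu2 (contRep_smul (-1) hv2),
    fun t ht => ?_⟩
  obtain ⟨a1, a2, a3⟩ := hu t ht
  obtain ⟨b1, b2, b3⟩ := hv t ht
  simp [a1, a2, a3, b1, b2, b3]

variable {R : ℝ} {g₀ : ℝ → ℝ}

lemma admB_subset_lateralSet (hεb : ε < b) (hT : 0 < T) : admB ε b T R g₀ ⊆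
    lateralSet ε b T (fun t => g₀ (t + ε)) (fun t => 2 * deriv g₀ (t + ε)) := by
  rintro q ⟨-, f, fx, h1, h2, h3, -⟩
  exact (lateralSet_iff hεb hT h1 h2).2 h3

/-- The lateral data are closed conditions and survive in the closure, so increments between
admissible functions are directions in which the gradient is defined. -/
lemma sub_mem_H40 (hεb : ε < b) (hT : 0 < T) {p q : H4 ε b T}
    (hp : p ∈ closure (admB ε b T R g₀)) (hq : q ∈ closure (admB ε b T R g₀)) :
    p - q ∈ H40 ε b T := by
  have h := closure_minimal (admB_subset_lateralSet (R := R) (g₀ := g₀) hεb hT)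
    (isClosed_lateralSet hεb hT _ _)
  exact lateralSet_sub hεb hT (h hp) (h hq)

lemma norm_le_of_mem_closure_admB {q : H4 ε b T} (hq : q ∈ closure (admB ε b T R g₀)) :
    ‖q‖ ≤ R := by
  have : closure (admB ε b T R g₀) ⊆ {q | ‖q‖ ≤ R} :=
    closure_minimal (fun q hq => hq.1.le) (isClosed_le continuous_norm continuous_const)
  exact this hq

lemma convex_admB : Convex ℝ (admB ε b T R g₀) := by
  rintro p ⟨np, f, fx, f1, f2, f3, f4⟩ q ⟨nq, g, gx, k1, k2, k3, k4⟩ s r hs hr hsr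
  refine ⟨?_, s • f + r • g, s • fx + r • gx,
    contRep_add (contRep_smul s f1) (contRep_smul r k1),
    contRep_add (contRep_smul s f2) (contRep_smul r k2), fun t ht => ?_, fun x hx => ?_⟩
  · have h1 : Convex ℝ (Metric.ball (0 : H4 ε b T) R) := convex_ball 0 R
    have := h1 (x := p) (by simpa using np) (y := q) (by simpa using nq) hs hr hsr
    simpa using this
  · obtain ⟨a1, a2, a3⟩ := f3 t ht
    obtain ⟨b1, b2, b3⟩ := k3 t ht
    simp only [Pi.add_apply, Pi.smul_apply, smul_eq_mul, a1, a2, a3, b1, b2, b3]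
    refine ⟨?_, ?_, by simp⟩ <;> rw [← add_mul, hsr, one_mul]
  · obtain ⟨a1, a2⟩ := f4 x hx
    obtain ⟨b1, b2⟩ := k4 x hx
    have h1 : Convex ℝ (Icc (qLow b) (1 / 2)) := convex_Icc _ _
    exact h1 (x := f (x, 0)) ⟨a1, a2⟩ (y := g (x, 0)) ⟨b1, b2⟩ hs hr hsr

end

/-! ### Quadratic functionals on Hilbert spaces. -/

section Quadratic

variable {E F : Type*} [NormedAddCommGroup E] [InnerProductSpace ℝ E]
  [NormedAddCommGroup F] [InnerProductSpace ℝ F]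

/-- The quadratic functional `q ↦ ‖A q + B‖² + β ‖q‖²`. -/
def quadF (A : E →L[ℝ] F) (B : F) (β : ℝ) (q : E) : ℝ := ‖A q + B‖ ^ 2 + β * ‖q‖ ^ 2

/-- The first variation of `quadF` at `q` in the direction `h`. -/
def quadD (A : E →L[ℝ] F) (B : F) (β : ℝ) (q h : E) : ℝ :=
  2 * inner ℝ (A q + B) (A h) + 2 * β * inner ℝ q h

variable (A : E →L[ℝ] F) (B : F) (β : ℝ)

/-- An exact second order expansion. Differentiability, convexity and the variational inequality are
all read off from it. -/
lemma quadF_add (q h : E) : quadF A B β (q + h) =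
    quadF A B β q + quadD A B β q h + (‖A h‖ ^ 2 + β * ‖h‖ ^ 2) := by
  have e : A (q + h) + B = (A q + B) + A h := by rw [map_add]; abel
  rw [quadF, quadF, quadD, e, norm_add_sq_real (A q + B), norm_add_sq_real q]
  ring

/-- The first variation restricted to S is represented in S by the Riesz theorem, and the remaining
quadratic term has zero derivative at 0. -/
lemma quadF_exists_gradient (S : Submodule ℝ E) [CompleteSpace S] (q : E) : ∃ g : S,
    HasFDerivAt (fun h : S => quadF A B β (q + (h : E))) (innerSL ℝ g) 0 ∧
      ∀ h : S, inner ℝ (g : E) (h : E) = quadD A B β q h := by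
  let ℓ : S →L[ℝ] ℝ := ((2 : ℝ) • (innerSL ℝ (A q + B)).comp A + (2 * β) • innerSL ℝ q).comp S.subtypeL
  have hℓ : ∀ h : S, ℓ h = quadD A B β q h := fun h => by
    simp only [ℓ, quadD]; rfl
  let g : S := (InnerProductSpace.toDual ℝ S).symm ℓ
  have hg : ∀ h : S, inner ℝ (g : E) (h : E) = quadD A B β q h := fun h => by
    rw [← hℓ, ← InnerProductSpace.toDual_symm_apply (𝕜 := ℝ) (x := h) (y := ℓ)]
    rfl
  refine ⟨g, ?_, hg⟩
  have e : (fun h : S => quadF A B β (q + (h : E))) = fun h : S =>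
      quadF A B β q + innerSL ℝ g h + (‖(A.comp S.subtypeL) h‖ ^ 2 + β * ‖h‖ ^ 2) := by
    ext h
    rw [quadF_add, ← hg h]
    rfl
  rw [e]
  have h1 : HasFDerivAt (fun h : S => ‖(A.comp S.subtypeL) h‖ ^ 2) (0 : S →L[ℝ] ℝ) 0 := by
    have h := ((A.comp S.subtypeL).hasFDerivAt (x := 0)).norm_sq
    rwa [map_zero, map_zero, ContinuousLinearMap.zero_comp, smul_zero] at h
  have h2 : HasFDerivAt (fun h : S => ‖h‖ ^ 2) (0 : S →L[ℝ] ℝ) 0 := by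
    have h := (hasFDerivAt_id (𝕜 := ℝ) (0 : S)).norm_sq
    rwa [id, map_zero, ContinuousLinearMap.zero_comp, smul_zero] at h
  have h3 := ((innerSL ℝ g).hasFDerivAt (x := 0)).const_add (quadF A B β q)
  simpa using h3.fun_add (h1.fun_add (h2.const_mul β))

/-- Derivatives are unique, so the explicit formula holds for every gradient and not only for the
one constructed above. -/
lemma quadF_gradient_eq (S : Submodule ℝ E) [CompleteSpace S] {q : E} {g : S}
    (hg : HasFDerivAt (fun h : S => quadF A B β (q + (h : E))) (innerSL ℝ g) 0) (h : S) :
    inner ℝ (g : E) (h : E) = quadD A B β q h := by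
  obtain ⟨g', hg', hq⟩ := quadF_exists_gradient A B β S q
  have : innerSL ℝ g = innerSL ℝ g' := hg.unique hg'
  rw [← hq]
  exact DFunLike.congr_fun this h

lemma quadD_sub (q₁ q₂ h : E) : quadD A B β q₂ h - quadD A B β q₁ h =
    2 * inner ℝ (A (q₂ - q₁)) (A h) + 2 * β * inner ℝ (q₂ - q₁) h := by
  have : A (q₂ - q₁) = (A q₂ + B) - (A q₁ + B) := by rw [map_sub]; abel
  rw [this, inner_sub_left, inner_sub_left, quadD, quadD]
  ring

lemma quadF_gradient_lipschitz (S : Submodule ℝ E) [CompleteSpace S] {q₁ q₂ : E} {g₁ g₂ : S}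
    (hg₁ : HasFDerivAt (fun h : S => quadF A B β (q₁ + (h : E))) (innerSL ℝ g₁) 0)
    (hg₂ : HasFDerivAt (fun h : S => quadF A B β (q₂ + (h : E))) (innerSL ℝ g₂) 0) :
    ‖(g₂ : E) - (g₁ : E)‖ ≤ (2 * ‖A‖ ^ 2 + 2 * |β| + 1) * ‖q₂ - q₁‖ := by
  set d : S := g₂ - g₁ with hd
  -- The difference of the gradients is tested against itself; the contribution of B cancels, and
  -- one factor ‖d‖ is divided out at the end.
  have e : ‖(d : E)‖ ^ 2 = 2 * inner ℝ (A (q₂ - q₁)) (A d) + 2 * β * inner ℝ (q₂ - q₁) (d : E) := by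
    rw [← quadD_sub, ← quadF_gradient_eq A B β S hg₁, ← quadF_gradient_eq A B β S hg₂,
      ← inner_sub_left, ← real_inner_self_eq_norm_sq]
    rfl
  have i1 : inner ℝ (A (q₂ - q₁)) (A d) ≤ ‖A‖ ^ 2 * ‖q₂ - q₁‖ * ‖(d : E)‖ := by
    refine (real_inner_le_norm _ _).trans ?_
    calc _ ≤ (‖A‖ * ‖q₂ - q₁‖) * (‖A‖ * ‖(d : E)‖) :=
          mul_le_mul (A.le_opNorm _) (A.le_opNorm _) (norm_nonneg _) (by positivity)
      _ = _ := by ring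
  have i2 : β * inner ℝ (q₂ - q₁) (d : E) ≤ |β| * (‖q₂ - q₁‖ * ‖(d : E)‖) := by
    refine (le_abs_self _).trans ?_
    rw [abs_mul]
    exact mul_le_mul_of_nonneg_left (abs_real_inner_le_norm _ _) (abs_nonneg _)
  change ‖(d : E)‖ ≤ _
  rcases (norm_nonneg (d : E)).eq_or_lt with h0 | h0
  · rw [← h0]; positivity
  · have h3 : 0 ≤ ‖q₂ - q₁‖ * ‖(d : E)‖ := by positivity
    refine le_of_mul_le_mul_right ?_ h0
    nlinarith

/-- The convexity gap between x and y equals r s (‖A(y - x)‖² + β‖y - x‖²), which is positive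
because β > 0. -/
lemma quadF_strictConvexOn {K : Set E} (hK : Convex ℝ K) (hβ : 0 < β) :
    StrictConvexOn ℝ K (quadF A B β) := by
  refine ⟨hK, fun x _ y _ hxy s r hs hr hsr => ?_⟩
  have hr' : r = 1 - s := by linarith
  have hxy' : 0 < ‖y - x‖ := norm_pos_iff.2 (sub_ne_zero.2 hxy.symm)
  have e1 : s • x + r • y = x + r • (y - x) := by
    rw [hr', smul_sub, sub_smul, sub_smul, one_smul, one_smul]; abel
  have e2 : y = x + (y - x) := by abel
  have f1 := quadF_add A B β x (r • (y - x))
  have f2 := quadF_add A B β x (y - x)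
  rw [← e2] at f2
  rw [e1, f1, f2]
  have e3 : quadD A B β x (r • (y - x)) = r * quadD A B β x (y - x) := by
    simp only [quadD, map_smul, inner_smul_right]; ring
  rw [e3, map_smul, norm_smul, norm_smul, mul_pow, mul_pow, Real.norm_eq_abs, sq_abs,
    smul_eq_mul, smul_eq_mul]
  have hQ : 0 < ‖A (y - x)‖ ^ 2 + β * ‖y - x‖ ^ 2 := by positivity
  have : 0 < r * s * (‖A (y - x)‖ ^ 2 + β * ‖y - x‖ ^ 2) := by positivity
  have hs' : s = 1 - r := by linarith
  rw [hs'] at this ⊢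
  nlinarith

/-- The functional is the squared distance from (-B, 0) to (A q, √β q), so a minimizer is given by
the projection onto a complete convex set. -/
lemma quadF_exists_minimizer [CompleteSpace E] {K : Set E} (hK : Convex ℝ K) (hc : IsClosed K)
    (hne : K.Nonempty) (hβ : 0 < β) : ∃ p ∈ K, ∀ q ∈ K, quadF A B β p ≤ quadF A B β q := by
  let Φ : E →L[ℝ] WithLp 2 (F × E) :=
    (WithLp.prodContinuousLinearEquiv 2 ℝ F E).symm.toContinuousLinearMap.comp
      (A.prod (Real.sqrt β • ContinuousLinearMap.id ℝ E))
  let y : WithLp 2 (F × E) := WithLp.toLp 2 (-B, 0)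
  have hΦ : ∀ q, ‖y - Φ q‖ ^ 2 = quadF A B β q := by
    intro q
    rw [WithLp.prod_norm_sq_eq_of_L2, quadF]
    have h1 : (y - Φ q).fst = -(A q + B) := by
      change -B - A q = _
      abel
    have h2 : (y - Φ q).snd = -(Real.sqrt β • q) := by
      change 0 - Real.sqrt β • q = _
      abel
    rw [h1, h2, norm_neg, norm_neg, norm_smul, mul_pow, Real.norm_eq_abs, sq_abs,
      Real.sq_sqrt hβ.le]
  -- The component √β q bounds Φ from below; hence Φ maps the closed set K onto a complete one.
  have hanti : AntilipschitzWith (Real.toNNReal (Real.sqrt β))⁻¹ Φ := by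
    have hs : 0 < Real.sqrt β := Real.sqrt_pos.2 hβ
    apply ContinuousLinearMap.antilipschitz_of_bound
    intro q
    have h1 : Real.sqrt β * ‖q‖ ≤ ‖Φ q‖ := by
      have h2 : ‖Φ q‖ ^ 2 = ‖A q‖ ^ 2 + (Real.sqrt β * ‖q‖) ^ 2 := by
        rw [WithLp.prod_norm_sq_eq_of_L2]
        have h3 : (Φ q).snd = Real.sqrt β • q := rfl
        have h4 : (Φ q).fst = A q := rfl
        rw [h3, h4, norm_smul, Real.norm_eq_abs, abs_of_pos hs]
      refine le_of_sq_le_sq ?_ (norm_nonneg _)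
      rw [h2]
      nlinarith [sq_nonneg ‖A q‖]
    rw [NNReal.coe_inv, Real.coe_toNNReal _ hs.le, inv_mul_eq_div, le_div_iff₀ hs]
    linarith
  have hcomp : IsComplete (Φ '' K) :=
    (isComplete_image_iff (hanti.isUniformInducing Φ.uniformContinuous)).2 hc.isComplete
  obtain ⟨v, ⟨p, hp, rfl⟩, hv⟩ := exists_norm_eq_iInf_of_complete_convex (hne.image Φ) hcomp
    (hK.linear_image Φ.toLinearMap) y
  refine ⟨p, hp, fun q hq => ?_⟩
  rw [← hΦ, ← hΦ]
  refine pow_le_pow_left₀ (norm_nonneg _) ?_ 2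
  rw [hv]
  exact ciInf_le ⟨0, by rintro _ ⟨w, rfl⟩; exact norm_nonneg _⟩
    (⟨Φ q, mem_image_of_mem Φ hq⟩ : ↥(Φ '' K))

end Quadratic

/-! ### The coefficients, and `J` as a quadratic functional. -/

lemma qLow_pos {b : ℝ} (hb : 1 < b) : 0 < qLow b := by
  unfold qLow
  have : 0 < b ^ (1 / 4 : ℝ) := Real.rpow_pos_of_pos (by linarith) _
  positivity

lemma qLow_le {b : ℝ} (hb : 1 < b) : qLow b ≤ 1 / 2 := by
  unfold qLow
  have : 1 ≤ b ^ (1 / 4 : ℝ) := Real.one_le_rpow hb.le (by norm_num)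
  exact one_div_le_one_div_of_le (by norm_num) (by linarith)

/-- An upper bound for the coefficients `coefA`. -/
def cMax (b : ℝ) : ℝ := 1 / (2 * qLow b ^ 2)

lemma trunc_mem {L y : ℝ} (hL : L ≤ 1 / 2) : max L (min (1 / 2) y) ∈ Icc L (1 / 2) :=
  ⟨le_max_left _ _, max_le hL (min_le_left _ _)⟩

/-- The truncation enters here: p ≤ 1/2 gives the lower bound 2 and p ≥ L the upper bound, whatever
the previous minimizer is. -/
lemma coef_mem {L p : ℝ} (hL : 0 < L) (hp : p ∈ Icc L (1 / 2)) :
    1 / (2 * p ^ 2) ∈ Icc 2 (1 / (2 * L ^ 2)) := by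
  have hp0 : 0 < p := hL.trans_le hp.1
  refine ⟨?_, ?_⟩
  · rw [le_div_iff₀ (by positivity)]
    nlinarith [hp.2]
  · apply one_div_le_one_div_of_le (by positivity)
    have := pow_le_pow_left₀ hL.le hp.1 2
    linarith

lemma two_le_cMax {b : ℝ} (hb : 1 < b) : 2 ≤ cMax b :=
  (coef_mem (qLow_pos hb) ⟨le_rfl, qLow_le hb⟩).1

lemma coef_lipschitz {L p r : ℝ} (hL : 0 < L) (hp : p ∈ Icc L (1 / 2)) (hr : r ∈ Icc L (1 / 2)) :
    |1 / (2 * p ^ 2) - 1 / (2 * r ^ 2)| ≤ 1 / (2 * L ^ 4) * |p - r| := by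
  have hp0 : 0 < p := hL.trans_le hp.1
  have hr0 : 0 < r := hL.trans_le hr.1
  have e : 1 / (2 * p ^ 2) - 1 / (2 * r ^ 2) = ((r + p) / (2 * (p ^ 2 * r ^ 2))) * (r - p) := by
    field_simp; ring
  rw [e, abs_mul, abs_sub_comm r p, abs_of_nonneg (by positivity)]
  refine mul_le_mul_of_nonneg_right ?_ (abs_nonneg _)
  have h4 : L ^ 4 ≤ p ^ 2 * r ^ 2 := by
    have h1 := pow_le_pow_left₀ hL.le hp.1 2
    have h2 := pow_le_pow_left₀ hL.le hr.1 2
    calc L ^ 4 = L ^ 2 * L ^ 2 := by ring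
      _ ≤ _ := mul_le_mul h1 h2 (by positivity) (by positivity)
  exact div_le_div₀ zero_le_one (by linarith [hp.2, hr.2]) (by positivity) (by linarith)

lemma trunc_lipschitz (L x y : ℝ) :
    |max L (min (1 / 2) x) - max L (min (1 / 2) y)| ≤ |x - y| := by
  refine (abs_max_sub_max_le_max _ _ _ _).trans ?_
  rw [sub_self, abs_zero]
  refine max_le (abs_nonneg _) ((abs_min_sub_min_le_max _ _ _ _).trans ?_)
  rw [sub_self, abs_zero]
  exact max_le (abs_nonneg _) le_rfl

section

variable {ε b T : ℝ}

lemma ClassicalRep.isContRep {u : H4 ε b T} {B : ℝ} {f fx ft fxx fxt : ℝ × ℝ → ℝ}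
    (h : ClassicalRep u B f fx ft fxx fxt) :
    IsContRep ε b T (u.D 0 0) f ∧ IsContRep ε b T (u.D 1 0) fx :=
  ⟨⟨h.cont_f.continuousOn, h.ae_f⟩, ⟨h.cont_fx.continuousOn, h.ae_fx⟩⟩

/-- On `[ε, b]` the coefficient is a continuous function with values in `[2, cMax b]`. -/
lemma coefA_classical (hεb : ε < b) (hb : 1 < b) (hT : 0 < T) (m : ℕ → H4 ε b T) (n : ℕ) :
    ∃ c : ℝ → ℝ, Continuous c ∧ (∀ x ∈ Icc ε b, coefA m n x = c x) ∧
      ∀ x, c x ∈ Icc 2 (cMax b) := by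
  cases n with
  | zero => exact ⟨fun _ => 2, continuous_const, fun x _ => rfl, fun x => ⟨le_rfl, two_le_cMax hb⟩⟩
  | succ k =>
    obtain ⟨C, hC, hrep⟩ := exists_classicalRep hεb hT
    obtain ⟨f, fx, ft, fxx, fxt, hr⟩ := hrep (m k)
    have hL := qLow_pos hb
    have hmem : ∀ x, max (qLow b) (min (1 / 2) (f (x, 0))) ∈ Icc (qLow b) (1 / 2) := fun x =>
      trunc_mem (qLow_le hb)
    refine ⟨fun x => 1 / (2 * (max (qLow b) (min (1 / 2) (f (x, 0)))) ^ 2), ?_, fun x hx => ?_,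
      fun x => coef_mem hL (hmem x)⟩
    · have := hr.cont_f
      refine continuous_const.div (by fun_prop) fun x => ?_
      have := hL.trans_le (hmem x).1
      positivity
    · simp only [coefA, qTrunc]
      rw [hr.isContRep.1.contRep_eqOn hεb hT (mem_OmBar_bottom hT hx)]

/-- The coefficient is Lipschitz on `[ε, b]`, uniformly for minimizers of norm at most `R`. -/
lemma coefA_lipschitz (hεb : ε < b) (hb : 1 < b) (hT : 0 < T) (R : ℝ) : ∃ M : ℝ, 0 < M ∧
    ∀ (m : ℕ → H4 ε b T) (n : ℕ), (∀ k < n, ‖m k‖ ≤ R) →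
      ∀ x ∈ Icc ε b, ∀ y ∈ Icc ε b, |coefA m n x - coefA m n y| ≤ M * |x - y| := by
  obtain ⟨C, hC, hrep⟩ := exists_classicalRep hεb hT
  have hL := qLow_pos hb
  -- The product of the Lipschitz constant of p ↦ 1/(2p²) and the bound C|R| for the x-derivative of
  -- the minimizer; the summand 1 ensures M > 0.
  refine ⟨1 / (2 * qLow b ^ 4) * (C * |R|) + 1, by positivity, fun m n hm x hx y hy => ?_⟩
  cases n with
  | zero =>
    simp only [coefA, sub_self, abs_zero]
    positivity
  | succ k =>
    obtain ⟨f, fx, ft, fxx, fxt, hr⟩ := hrep (m k)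
    have hmem : ∀ x, qTrunc (m k) x ∈ Icc (qLow b) (1 / 2) := fun x => trunc_mem (qLow_le hb)
    simp only [coefA]
    refine (coef_lipschitz hL (hmem x) (hmem y)).trans ?_
    have h1 : |qTrunc (m k) x - qTrunc (m k) y| ≤ C * |R| * |x - y| := by
      refine (trunc_lipschitz _ _ _).trans ?_
      rw [hr.isContRep.1.contRep_eqOn hεb hT (mem_OmBar_bottom hT hx),
        hr.isContRep.1.contRep_eqOn hεb hT (mem_OmBar_bottom hT hy),
        hr.f_x x hx 0 (left_mem_Icc.2 hT.le), hr.f_x y hy 0 (left_mem_Icc.2 hT.le),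
        add_sub_add_left_eq_sub]
      have hc : Continuous fun s => fx (s, 0) := by have := hr.cont_fx; fun_prop
      rw [intervalIntegral.integral_interval_sub_left (hc.intervalIntegrable _ _)
        (hc.intervalIntegrable _ _), ← Real.norm_eq_abs]
      refine (intervalIntegral.norm_integral_le_of_norm_le_const
        (C := C * ‖m k‖) fun s _ => hr.bound_fx _).trans ?_
      have : ‖m k‖ ≤ |R| := (hm k (Nat.lt_succ_self k)).trans (le_abs_self R)
      gcongr
    have h2 := mul_le_mul_of_nonneg_left h1 (by positivity : 0 ≤ 1 / (2 * qLow b ^ 4))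
    have h3 := abs_nonneg (x - y)
    nlinarith

/-- Multiplication by a bounded measurable function, as an operator on `L²(Ω)`. -/
lemma exists_mulLp {g : ℝ × ℝ → ℝ} (hg : AEStronglyMeasurable g (muOm ε b T)) {K : ℝ}
    (hK : ∀ᵐ z ∂(muOm ε b T), |g z| ≤ K) :
    ∃ M : L2 ε b T →L[ℝ] L2 ε b T, ∀ u, M u =ᵐ[muOm ε b T] fun z => g z * u z := by
  have hm : ∀ u : L2 ε b T, MemLp (fun z => g z * u z) 2 (muOm ε b T) := fun u => by
    refine (Lp.memLp u).of_le_mul (c := K) (hg.mul (Lp.aestronglyMeasurable u)) ?_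
    filter_upwards [hK] with z hz
    rw [norm_mul]
    exact mul_le_mul_of_nonneg_right hz (norm_nonneg _)
  have hco : ∀ u, (hm u).toLp _ =ᵐ[muOm ε b T] fun z => g z * u z := fun u => (hm u).coeFn_toLp
  refine ⟨LinearMap.mkContinuous
    { toFun := fun u => (hm u).toLp _
      map_add' := fun u v => ?_
      map_smul' := fun c u => ?_ } K fun u => ?_, hco⟩
  · apply Lp.ext
    filter_upwards [hco (u + v), hco u, hco v, Lp.coeFn_add u v,
      Lp.coeFn_add ((hm u).toLp _) ((hm v).toLp _)] with z h1 h2 h3 h4 h5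
    rw [h1, h5, Pi.add_apply, h2, h3, h4, Pi.add_apply, mul_add]
  · apply Lp.ext
    filter_upwards [hco (c • u), hco u, Lp.coeFn_smul c u,
      Lp.coeFn_smul c ((hm u).toLp _)] with z h1 h2 h3 h4
    rw [h1, RingHom.id_apply, h4, Pi.smul_apply, h2, h3, Pi.smul_apply, smul_eq_mul, smul_eq_mul]
    ring
  · refine Lp.norm_le_mul_norm_of_ae_le_mul ?_
    filter_upwards [hco u, hK] with z h1 h2
    change ‖(hm u).toLp _ z‖ ≤ _
    rw [h1, norm_mul]
    exact mul_le_mul_of_nonneg_right h2 (norm_nonneg _)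

/-- Taking a weak derivative, as an operator from `H⁴(Ω)` to `L²(Ω)`. -/
def derivCLM (i j : Fin 5) (h : (i : ℕ) + (j : ℕ) ≤ 4) : H4 ε b T →L[ℝ] L2 ε b T :=
  LinearMap.mkContinuous
    { toFun := fun u => u.D i j h
      map_add' := fun _ _ => rfl
      map_smul' := fun _ _ => rfl } 1 fun u => by
    rw [one_mul]; exact u.norm_D_le i j h

/-- The square root of the Carleman weight. -/
def sqrtWeight (α lam : ℝ) (z : ℝ × ℝ) : ℝ := Real.exp (-lam * (z.1 + α * z.2))

lemma sqrtWeight_sq (α lam : ℝ) (z : ℝ × ℝ) : sqrtWeight α lam z ^ 2 = weight α lam z := by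
  rw [sqrtWeight, weight, ← Real.exp_nat_mul]
  congr 1
  push_cast
  ring

lemma ae_mem_Om : ∀ᵐ z ∂(muOm ε b T), z ∈ Om ε b T :=
  ae_restrict_mem (isOpen_Ioo.prod isOpen_Ioo).measurableSet

lemma exists_mul_continuous {g : ℝ × ℝ → ℝ} (hg : Continuous g) :
    ∃ M : L2 ε b T →L[ℝ] L2 ε b T, ∀ u, M u =ᵐ[muOm ε b T] fun z => g z * u z := by
  obtain ⟨K, hK⟩ := (isCompact_Icc.prod isCompact_Icc :
    IsCompact (Icc ε b ×ˢ Icc 0 T)).exists_bound_of_continuousOn hg.continuousOn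
  refine exists_mulLp (K := K) hg.aestronglyMeasurable ?_
  filter_upwards [ae_mem_Om] with z hz
  exact hK z ⟨Ioo_subset_Icc_self hz.1, Ioo_subset_Icc_self hz.2⟩

lemma continuous_sqrtWeight (α lam : ℝ) : Continuous (sqrtWeight α lam) := by
  unfold sqrtWeight; fun_prop

/-- Putting the square root of the weight into the operator turns the weighted integral into an
ordinary L² norm. -/
lemma exists_opA_clm (hεb : ε < b) (hb : 1 < b) (hT : 0 < T) (α lam : ℝ) (m : ℕ → H4 ε b T)
    (n : ℕ) : ∃ A : H4 ε b T →L[ℝ] L2 ε b T, ∀ q : H4 ε b T,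
      A q =ᵐ[muOm ε b T] fun z => sqrtWeight α lam z * opA m n q z := by
  obtain ⟨c, hc, hcA, -⟩ := coefA_classical hεb hb hT m n
  have hw := continuous_sqrtWeight α lam
  obtain ⟨M₁, hM₁⟩ := exists_mul_continuous (ε := ε) (b := b) (T := T) hw
  obtain ⟨M₂, hM₂⟩ := exists_mul_continuous (ε := ε) (b := b) (T := T)
    (g := fun z => sqrtWeight α lam z * c z.1) (by fun_prop)
  refine ⟨M₁.comp (derivCLM 2 0 (by decide)) - M₂.comp (derivCLM 1 1 (by decide)), fun q => ?_⟩
  have e := Lp.coeFn_sub (M₁ (q.D 2 0)) (M₂ (q.D 1 1))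
  filter_upwards [e, hM₁ (q.D 2 0), hM₂ (q.D 1 1), ae_mem_Om] with z h1 h2 h3 hz
  change (M₁ (q.D 2 0) - M₂ (q.D 1 1) : L2 ε b T) z = _
  rw [h1, Pi.sub_apply, h2, h3, opA, hcA z.1 (Ioo_subset_Icc_self hz.1)]
  ring

lemma exists_termB (hεb : ε < b) (hb : 1 < b) (hT : 0 < T) (α lam : ℝ) (m : ℕ → H4 ε b T)
    (n : ℕ) : ∃ B : L2 ε b T,
      B =ᵐ[muOm ε b T] fun z => sqrtWeight α lam z * termB m n z := by
  cases n with
  | zero =>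
    refine ⟨0, ?_⟩
    filter_upwards [Lp.coeFn_zero ℝ 2 (muOm ε b T)] with z hz
    rw [hz]; simp [termB]
  | succ k =>
    obtain ⟨C, hC, hrep⟩ := exists_classicalRep hεb hT
    obtain ⟨f, fx, ft, fxx, fxt, hr⟩ := hrep (m k)
    have hL := qLow_pos hb
    have hmem : ∀ x, max (qLow b) (min (1 / 2) (f (x, 0))) ∈ Icc (qLow b) (1 / 2) := fun x =>
      trunc_mem (qLow_le hb)
    have hw := continuous_sqrtWeight α lam
    have hc : Continuous fun z : ℝ × ℝ => sqrtWeight α lam z *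
        (fx (z.1, 0) / (2 * (max (qLow b) (min (1 / 2) (f (z.1, 0)))) ^ 3)) := by
      have h1 := hr.cont_f
      have h2 := hr.cont_fx
      refine hw.mul (Continuous.div (by fun_prop) (by fun_prop) fun z => ?_)
      have := hL.trans_le (hmem z.1).1
      positivity
    obtain ⟨M, hM⟩ := exists_mul_continuous (ε := ε) (b := b) (T := T) hc
    refine ⟨M ((m k).D 0 1), ?_⟩
    filter_upwards [hM ((m k).D 0 1), ae_mem_Om] with z h1 hz
    have hz' := mem_OmBar_bottom (ε := ε) (b := b) hT (Ioo_subset_Icc_self hz.1)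
    rw [h1, termB, qTrunc, hr.isContRep.1.contRep_eqOn hεb hT hz',
      hr.isContRep.2.contRep_eqOn hεb hT hz']
    ring

/-- The functional `J` is of the form `q ↦ ‖A q + B‖² + β ‖q‖²`. -/
lemma exists_J_eq_quadF (hεb : ε < b) (hb : 1 < b) (hT : 0 < T) (α lam β : ℝ)
    (m : ℕ → H4 ε b T) (n : ℕ) : ∃ (A : H4 ε b T →L[ℝ] L2 ε b T) (B : L2 ε b T),
      (J α lam β m n = quadF A B β) ∧
      (∀ q h : H4 ε b T, quadD A B β q h =
        2 * (∫ z in Om ε b T, (opA m n q z + termB m n z) * opA m n h z * weight α lam z)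
          + 2 * β * inner ℝ q h) ∧
      ∀ h : H4 ε b T, ‖A h‖ ^ 2 = ∫ z in Om ε b T, opA m n h z ^ 2 * weight α lam z := by
  obtain ⟨A, hA⟩ := exists_opA_clm hεb hb hT α lam m n
  obtain ⟨B, hB⟩ := exists_termB hεb hb hT α lam m n
  have hAB : ∀ q, (A q + B : L2 ε b T) =ᵐ[muOm ε b T]
      fun z => sqrtWeight α lam z * (opA m n q z + termB m n z) := fun q => by
    filter_upwards [Lp.coeFn_add (A q) B, hA q, hB] with z h1 h2 h3
    rw [h1, Pi.add_apply, h2, h3]; ring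
  refine ⟨A, B, ?_, fun q h => ?_, fun h => ?_⟩
  · ext q
    rw [J, quadF, L2_norm_sq]
    congr 1
    apply integral_congr_ae
    filter_upwards [hAB q] with z hz
    rw [hz, mul_pow, sqrtWeight_sq]; ring
  · rw [quadD, L2.inner_def]
    congr 2
    apply integral_congr_ae
    filter_upwards [hAB q, hA h] with z h1 h2
    rw [h1, h2, ← sqrtWeight_sq]
    simp only [RCLike.inner_apply, conj_trivial]
    ring
  · rw [L2_norm_sq]
    apply integral_congr_ae
    filter_upwards [hA h] with z hz
    rw [hz, mul_pow, sqrtWeight_sq]; ring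

end

/-! ### Weighted inequalities in one variable. -/

section OneDim

variable {a b : ℝ} {g g' : ℝ → ℝ}

lemma hasDerivAt_of_eq_add_integral (hg' : Continuous g')
    (h : ∀ x ∈ Icc a b, g x = g a + ∫ s in a..x, g' s) {x : ℝ} (hx : x ∈ Ioo a b) :
    HasDerivAt g (g' x) x := by
  have h1 : HasDerivAt (fun x => g a + ∫ s in a..x, g' s) (g' x) x :=
    (intervalIntegral.integral_hasDerivAt_right (hg'.intervalIntegrable _ _)
      (hg'.stronglyMeasurableAtFilter _ _) hg'.continuousAt).const_add _
  refine h1.congr_of_eventuallyEq ?_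
  filter_upwards [Icc_mem_nhds hx.1 hx.2] with y hy
  exact h y hy

lemma absolutelyContinuous_of_eq_add_integral (hab : a ≤ b) (hg' : Continuous g')
    (h : ∀ x ∈ Icc a b, g x = g a + ∫ s in a..x, g' s) :
    AbsolutelyContinuousOnInterval g a b := by
  obtain ⟨K, hK⟩ := (isCompact_Icc (a := a) (b := b)).exists_bound_of_continuousOn hg'.continuousOn
  refine (LipschitzOnWith.of_dist_le_mul (K := Real.toNNReal K)
    fun x hx y hy => ?_).absolutelyContinuousOnInterval
  rw [uIcc_of_le hab] at hx hy
  have hK0 : 0 ≤ K := (norm_nonneg _).trans (hK x hx)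
  rw [Real.coe_toNNReal _ hK0, Real.dist_eq, Real.dist_eq, h x hx, h y hy,
    add_sub_add_left_eq_sub, intervalIntegral.integral_interval_sub_left
      (hg'.intervalIntegrable _ _) (hg'.intervalIntegrable _ _)]
  refine intervalIntegral.norm_integral_le_of_norm_le_const fun s hs => hK s ?_
  exact uIcc_subset_Icc hy hx (uIoc_subset_uIcc hs)

lemma hasDerivAt_exp_weight (κ μ x : ℝ) : HasDerivAt (fun x => Real.exp (-2 * κ * x + μ))
    (Real.exp (-2 * κ * x + μ) * (-2 * κ)) x := by
  have := (((hasDerivAt_id x).const_mul (-2 * κ)).add_const μ).exp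
  rwa [mul_one] at this

/-- Integration by parts against an exponential weight. -/
lemma integral_mul_deriv_mul_exp (hab : a ≤ b) (hg : Continuous g) (hg' : Continuous g')
    (h : ∀ x ∈ Icc a b, g x = g a + ∫ s in a..x, g' s) (κ μ : ℝ) :
    ∫ x in a..b, g x * g' x * Real.exp (-2 * κ * x + μ) =
      (g b ^ 2 * Real.exp (-2 * κ * b + μ) - g a ^ 2 * Real.exp (-2 * κ * a + μ)) / 2 +
        κ * ∫ x in a..b, g x ^ 2 * Real.exp (-2 * κ * x + μ) := by
  have key := intervalIntegral.integral_eq_sub_of_hasDerivAt_of_le hab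
    (f := fun x => g x ^ 2 * Real.exp (-2 * κ * x + μ))
    (f' := fun x => 2 * (g x * g' x * Real.exp (-2 * κ * x + μ)) -
      2 * κ * (g x ^ 2 * Real.exp (-2 * κ * x + μ))) (by fun_prop) (fun x hx => by
        have h1 := (hasDerivAt_of_eq_add_integral hg' h hx).fun_pow 2
        refine (h1.fun_mul (hasDerivAt_exp_weight κ μ x)).congr_deriv ?_
        push_cast
        ring)
    ((by fun_prop : Continuous _).intervalIntegrable _ _)
  rw [intervalIntegral.integral_sub
    ((by fun_prop : Continuous _).intervalIntegrable _ _)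
    ((by fun_prop : Continuous _).intervalIntegrable _ _),
    intervalIntegral.integral_const_mul, intervalIntegral.integral_const_mul] at key
  linarith

/-- A Hardy type inequality with exponential weight for absolutely continuous functions. -/
lemma hardy_exp (hab : a ≤ b) {y W : ℝ → ℝ} (hy : AbsolutelyContinuousOnInterval y a b)
    (hyc : Continuous y) (hW : Continuous W) (ha : y a = 0) {κ : ℝ} (hκ : 0 < κ) (μ : ℝ)
    (hd : ∀ᵐ x, x ∈ Ioo a b → deriv y x ^ 2 ≤ W x) :
    κ ^ 2 * ∫ x in a..b, y x ^ 2 * Real.exp (-2 * κ * x + μ) ≤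
      ∫ x in a..b, W x * Real.exp (-2 * κ * x + μ) := by
  set e : ℝ → ℝ := fun x => Real.exp (-2 * κ * x + μ) with he
  have hec : Continuous e := by fun_prop
  have hed : ∀ x, HasDerivAt e (e x * (-2 * κ)) x := hasDerivAt_exp_weight κ μ
  have heA : AbsolutelyContinuousOnInterval e a b :=
    ContDiffOn.absolutelyContinuousOnInterval
      (by simp only [he]; exact ContDiff.contDiffOn (by fun_prop))
  -- The derivative of y² e is 2 y y' e - 2κ y² e, at most (y'²/κ - κ y²) e by Young's inequality;
  -- it is integrated from a, where y = 0, to b.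
  have hZ : AbsolutelyContinuousOnInterval (fun x => y x * (y x * e x)) a b :=
    hy.fun_mul (hy.fun_mul heA)
  have h1 := hZ.integral_deriv_eq_sub
  have h2 : ∫ x in a..b, deriv (fun x => y x * (y x * e x)) x ≤
      ∫ x in a..b, (κ⁻¹ * (W x * e x) - κ * (y x ^ 2 * e x)) := by
    refine intervalIntegral.integral_mono_ae_restrict hab hZ.intervalIntegrable_deriv
      ((by fun_prop : Continuous _).intervalIntegrable _ _) ?_
    rw [Filter.EventuallyLE, ← restrict_Ioo_eq_restrict_Icc, ae_restrict_iff' measurableSet_Ioo]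
    filter_upwards [hd, hy.ae_differentiableAt] with x hx1 hx2 hx
    have hx' : x ∈ uIcc a b := by rw [uIcc_of_le hab]; exact Ioo_subset_Icc_self hx
    have d1 := (hx2 hx').hasDerivAt
    have d2 := (d1.mul (d1.mul (hed x))).deriv
    change deriv (fun x => y x * (y x * e x)) x = _ at d2
    rw [d2]
    have hp : 0 < e x := Real.exp_pos _
    have hw := hx1 hx
    set p := deriv y x
    have q1 : 2 * (y x * p) ≤ κ * y x ^ 2 + κ⁻¹ * p ^ 2 := by
      have : 0 ≤ κ⁻¹ * (κ * y x - p) ^ 2 := by positivity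
      have e2 : κ⁻¹ * (κ * y x - p) ^ 2 = κ * y x ^ 2 - 2 * (y x * p) + κ⁻¹ * p ^ 2 := by
        field_simp; ring
      linarith
    have q2 : κ⁻¹ * p ^ 2 ≤ κ⁻¹ * W x := mul_le_mul_of_nonneg_left hw (by positivity)
    have q3 := mul_le_mul_of_nonneg_right (q1.trans (add_le_add_right q2 _)) hp.le
    simp only [Pi.mul_apply]
    linarith
  rw [h1, ha, intervalIntegral.integral_sub
    ((by fun_prop : Continuous _).intervalIntegrable _ _)
    ((by fun_prop : Continuous _).intervalIntegrable _ _),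
    intervalIntegral.integral_const_mul, intervalIntegral.integral_const_mul] at h2
  -- No condition at b is needed: the boundary term there has the favourable sign.
  have h3 : 0 ≤ y b * (y b * e b) := by
    rw [← mul_assoc]
    exact mul_nonneg (mul_self_nonneg _) (Real.exp_pos _).le
  have h4 : κ * (κ * ∫ x in a..b, y x ^ 2 * e x) ≤ κ * (κ⁻¹ * ∫ x in a..b, W x * e x) :=
    mul_le_mul_of_nonneg_left (by linarith) hκ.le
  rw [mul_inv_cancel_left₀ hκ.ne'] at h4
  rw [sq, mul_assoc]
  exact h4

/-- The inequality of Hardy type for continuously differentiable functions. -/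
lemma hardy_exp_of_eq_add_integral (hab : a ≤ b) (hg : Continuous g) (hg' : Continuous g')
    (h : ∀ x ∈ Icc a b, g x = g a + ∫ s in a..x, g' s) (ha : g a = 0) {κ : ℝ} (hκ : 0 < κ)
    (μ : ℝ) : κ ^ 2 * ∫ x in a..b, g x ^ 2 * Real.exp (-2 * κ * x + μ) ≤
      ∫ x in a..b, g' x ^ 2 * Real.exp (-2 * κ * x + μ) := by
  refine hardy_exp hab (absolutelyContinuous_of_eq_add_integral hab hg' h) hg
    (W := fun x => g' x ^ 2) (by fun_prop) ha hκ μ (Filter.Eventually.of_forall fun x hx => ?_)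
  rw [(hasDerivAt_of_eq_add_integral hg' h hx).deriv]

/-- The inequality of Hardy type for `v - c p` with a Lipschitz coefficient `c`. -/
lemma hardy_exp_sub_mul (hab : a ≤ b) {v v' p p' c : ℝ → ℝ} (hv : Continuous v)
    (hv' : Continuous v') (hp : Continuous p) (hp' : Continuous p') (hc : Continuous c)
    (hvv : ∀ x ∈ Icc a b, v x = v a + ∫ s in a..x, v' s)
    (hpp : ∀ x ∈ Icc a b, p x = p a + ∫ s in a..x, p' s) (hva : v a = 0) (hpa : p a = 0)
    {M : ℝ} (hM : 0 ≤ M) (hcl : ∀ x ∈ Icc a b, ∀ y ∈ Icc a b, |c x - c y| ≤ M * |x - y|)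
    {κ : ℝ} (hκ : 0 < κ) (μ : ℝ) :
    κ ^ 2 * ∫ x in a..b, (v x - c x * p x) ^ 2 * Real.exp (-2 * κ * x + μ) ≤
      ∫ x in a..b, (2 * (v' x - c x * p' x) ^ 2 + 2 * M ^ 2 * p x ^ 2) *
        Real.exp (-2 * κ * x + μ) := by
  have hlip : LipschitzOnWith (Real.toNNReal M) c (Icc a b) :=
    LipschitzOnWith.of_dist_le_mul fun x hx y hy => by
      rw [Real.coe_toNNReal _ hM]; exact hcl x hx y hy
  -- Truncation leaves c Lipschitz only, so c' exists almost everywhere and the absolutely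
  -- continuous form of the Hardy inequality is required.
  have hcA : AbsolutelyContinuousOnInterval c a b :=
    LipschitzOnWith.absolutelyContinuousOnInterval (by rw [uIcc_of_le hab]; exact hlip)
  have hvA := absolutelyContinuous_of_eq_add_integral hab hv' hvv
  have hpA := absolutelyContinuous_of_eq_add_integral hab hp' hpp
  refine hardy_exp hab (y := fun x => v x - c x * p x)
    (W := fun x => 2 * (v' x - c x * p' x) ^ 2 + 2 * M ^ 2 * p x ^ 2)
    (hvA.fun_sub (hcA.fun_mul hpA)) (by fun_prop) (by fun_prop) (by simp [hva, hpa]) hκ μ ?_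
  filter_upwards [hcA.ae_differentiableAt] with x hxd hx
  have hx' : x ∈ uIcc a b := by rw [uIcc_of_le hab]; exact Ioo_subset_Icc_self hx
  have d1 := hasDerivAt_of_eq_add_integral hv' hvv hx
  have d2 := hasDerivAt_of_eq_add_integral hp' hpp hx
  have d3 := (hxd hx').hasDerivAt
  have d4 : deriv (fun x => v x - c x * p x) x = v' x - (deriv c x * p x + c x * p' x) :=
    (d1.sub (d3.mul d2)).deriv
  rw [d4]
  have hb : |deriv c x| ≤ M := by
    have := norm_deriv_le_of_lipschitzOn (Icc_mem_nhds hx.1 hx.2) hlip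
    rwa [Real.coe_toNNReal _ hM] at this
  have hb2 : deriv c x ^ 2 ≤ M ^ 2 := sq_le_sq' (abs_le.1 hb).1 (abs_le.1 hb).2
  have hb3 := mul_le_mul_of_nonneg_right hb2 (sq_nonneg (p x))
  -- With X = v' - c p' and Y = c' p this is (X - Y)² ≤ 2X² + 2Y², followed by |c'| ≤ M.
  nlinarith [sq_nonneg (v' x - c x * p' x + deriv c x * p x)]

end OneDim

/-! ### Carleman estimates on the rectangle. -/

section TwoDim

variable {ε b T : ℝ}

lemma continuous_integrable_muOm {Φ : ℝ × ℝ → ℝ} (h : Continuous Φ) :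
    Integrable Φ (muOm ε b T) := by
  have h1 : IntegrableOn Φ (Icc ε b ×ˢ Icc 0 T) :=
    h.continuousOn.integrableOn_compact (isCompact_Icc.prod isCompact_Icc)
  exact h1.mono_set (prod_mono Ioo_subset_Icc_self Ioo_subset_Icc_self)

lemma intervalIntegral_eq_mI {a b : ℝ} (hab : a ≤ b) (g : ℝ → ℝ) :
    ∫ x in a..b, g x = ∫ x, g x ∂(mI a b) := by
  rw [intervalIntegral.integral_of_le hab, integral_Ioc_eq_integral_Ioo]

lemma integral_Om_eq_dt_dx (hεb : ε ≤ b) (hT : 0 ≤ T) {Φ : ℝ × ℝ → ℝ} (h : Continuous Φ) :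
    ∫ z in Om ε b T, Φ z = ∫ t in 0..T, ∫ x in ε..b, Φ (x, t) := by
  have hi : Integrable Φ ((mI ε b).prod (mI 0 T)) := by
    rw [← muOm_eq_prod]; exact continuous_integrable_muOm h
  change ∫ z, Φ z ∂(muOm ε b T) = _
  rw [muOm_eq_prod, integral_prod_symm _ hi, intervalIntegral_eq_mI hT]
  simp_rw [intervalIntegral_eq_mI hεb]

lemma integral_Om_eq_dx_dt (hεb : ε ≤ b) (hT : 0 ≤ T) {Φ : ℝ × ℝ → ℝ} (h : Continuous Φ) :
    ∫ z in Om ε b T, Φ z = ∫ x in ε..b, ∫ t in 0..T, Φ (x, t) := by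
  have hi : Integrable Φ ((mI ε b).prod (mI 0 T)) := by
    rw [← muOm_eq_prod]; exact continuous_integrable_muOm h
  change ∫ z, Φ z ∂(muOm ε b T) = _
  rw [muOm_eq_prod, integral_prod _ hi, intervalIntegral_eq_mI hεb]
  simp_rw [intervalIntegral_eq_mI hT]

lemma continuous_slice_integral {Φ : ℝ × ℝ → ℝ} (h : Continuous Φ) :
    Continuous fun t => ∫ x in ε..b, Φ (x, t) :=
  intervalIntegral.continuous_parametric_intervalIntegral_of_continuous'
    (f := fun t x => Φ (x, t)) (by unfold Function.uncurry; fun_prop) ε b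

lemma integral_Om_mono_slices (hεb : ε ≤ b) (hT : 0 ≤ T) {Φ Ψ : ℝ × ℝ → ℝ} (hΦ : Continuous Φ)
    (hΨ : Continuous Ψ)
    (h : ∀ t ∈ Icc 0 T, ∫ x in ε..b, Φ (x, t) ≤ ∫ x in ε..b, Ψ (x, t)) :
    ∫ z in Om ε b T, Φ z ≤ ∫ z in Om ε b T, Ψ z := by
  rw [integral_Om_eq_dt_dx hεb hT hΦ, integral_Om_eq_dt_dx hεb hT hΨ]
  exact intervalIntegral.integral_mono_on hT ((continuous_slice_integral hΦ).intervalIntegrable _ _)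
    ((continuous_slice_integral hΨ).intervalIntegrable _ _) h

lemma weight_slice_x (α lam x t : ℝ) :
    weight α lam (x, t) = Real.exp (-2 * lam * x + -2 * lam * α * t) := by
  rw [weight]; congr 1; ring

lemma weight_slice_t (α lam x t : ℝ) :
    weight α lam (x, t) = Real.exp (-2 * (lam * α) * t + -2 * lam * x) := by
  rw [weight]; congr 1; ring

lemma continuous_weight (α lam : ℝ) : Continuous (weight α lam) := by
  unfold weight; fun_prop

lemma weight_pos (α lam : ℝ) (z : ℝ × ℝ) : 0 < weight α lam z := Real.exp_pos _

/-- The weighted Hardy inequality on `Ω`. -/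
lemma hardy_Om (hεb : ε ≤ b) (hT : 0 ≤ T) {f fx : ℝ × ℝ → ℝ} (hf : Continuous f)
    (hfx : Continuous fx)
    (h : ∀ x ∈ Icc ε b, ∀ t ∈ Icc 0 T, f (x, t) = f (ε, t) + ∫ s in ε..x, fx (s, t))
    (h0 : ∀ t ∈ Icc 0 T, f (ε, t) = 0) {α lam : ℝ} (hlam : 0 < lam) :
    lam ^ 2 * ∫ z in Om ε b T, f z ^ 2 * weight α lam z ≤
      ∫ z in Om ε b T, fx z ^ 2 * weight α lam z := by
  have hw := continuous_weight α lam
  rw [← integral_const_mul]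
  refine integral_Om_mono_slices hεb hT (by fun_prop) (by fun_prop) fun t ht => ?_
  simp_rw [intervalIntegral.integral_const_mul, weight_slice_x]
  exact hardy_exp_of_eq_add_integral hεb (g := fun x => f (x, t)) (g' := fun x => fx (x, t))
    (by fun_prop) (by fun_prop) (fun x hx => h x hx t ht) (h0 t ht) hlam _

/-- The Carleman estimate for the transport operator `vₓ - c vₜ`. -/
lemma carleman_transport (hεb : ε ≤ b) (hT : 0 ≤ T) {v vx vt : ℝ × ℝ → ℝ} {c : ℝ → ℝ}
    (hv : Continuous v) (hvx : Continuous vx) (hvt : Continuous vt) (hc : Continuous c)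
    (hx : ∀ x ∈ Icc ε b, ∀ t ∈ Icc 0 T, v (x, t) = v (ε, t) + ∫ s in ε..x, vx (s, t))
    (ht : ∀ x ∈ Icc ε b, ∀ t ∈ Icc 0 T, v (x, t) = v (x, 0) + ∫ r in 0..t, vt (x, r))
    (hl : ∀ t ∈ Icc 0 T, v (ε, t) = 0) (hr : ∀ t ∈ Icc 0 T, v (b, t) = 0) {cm : ℝ}
    (hcm : ∀ x, c x ∈ Icc 2 cm) {α lam : ℝ} (hα : 0 < α) (hαc : α * cm ≤ 1 / 2) (hlam : 0 < lam) :
    lam ^ 2 / 4 * (∫ z in Om ε b T, v z ^ 2 * weight α lam z) +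
      lam * (∫ x in ε..b, v (x, 0) ^ 2 * weight α lam (x, 0)) ≤
    (∫ z in Om ε b T, (vx z - c z.1 * vt z) ^ 2 * weight α lam z) +
      lam * cm / 2 * ∫ x in ε..b, v (x, T) ^ 2 * weight α lam (x, T) := by
  have hw := continuous_weight α lam
  have I : ∀ {Φ : ℝ × ℝ → ℝ}, Continuous Φ →
      Integrable Φ ((volume : Measure (ℝ × ℝ)).restrict (Om ε b T)) :=
    fun h => continuous_integrable_muOm h
  -- The boundary terms at x = ε and x = b vanish because v does.
  have e1 : ∫ z in Om ε b T, v z * vx z * weight α lam z =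
      lam * ∫ z in Om ε b T, v z ^ 2 * weight α lam z := by
    rw [integral_Om_eq_dt_dx hεb hT (by fun_prop), integral_Om_eq_dt_dx hεb hT (by fun_prop),
      ← intervalIntegral.integral_const_mul]
    refine intervalIntegral.integral_congr fun t htt => ?_
    rw [uIcc_of_le hT] at htt
    simp_rw [weight_slice_x]
    have := integral_mul_deriv_mul_exp hεb (g := fun x => v (x, t)) (g' := fun x => vx (x, t))
      (by fun_prop) (by fun_prop) (fun x hxx => hx x hxx t htt) lam (-2 * lam * α * t)
    rw [this, hl t htt, hr t htt]
    ring
  -- Here t is integrated first: c depends on x alone and passes through the integration by parts in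
  -- t.
  have e2 : ∫ z in Om ε b T, c z.1 * (v z * vt z * weight α lam z) =
      (∫ x in ε..b, c x / 2 * (v (x, T) ^ 2 * weight α lam (x, T))) -
      (∫ x in ε..b, c x / 2 * (v (x, 0) ^ 2 * weight α lam (x, 0))) +
      ∫ z in Om ε b T, lam * α * c z.1 * (v z ^ 2 * weight α lam z) := by
    rw [integral_Om_eq_dx_dt hεb hT (by fun_prop), integral_Om_eq_dx_dt hεb hT (by fun_prop)]
    have hcs : Continuous fun x => ∫ t in 0..T, lam * α * c x * (v (x, t) ^ 2 * weight α lam (x, t)) :=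
      intervalIntegral.continuous_parametric_intervalIntegral_of_continuous'
        (f := fun x t => lam * α * c x * (v (x, t) ^ 2 * weight α lam (x, t)))
        (by unfold Function.uncurry; fun_prop) 0 T
    rw [← intervalIntegral.integral_sub ((by fun_prop : Continuous _).intervalIntegrable _ _)
      ((by fun_prop : Continuous _).intervalIntegrable _ _),
      ← intervalIntegral.integral_add ((by fun_prop : Continuous _).intervalIntegrable _ _)
      (hcs.intervalIntegrable _ _)]
    refine intervalIntegral.integral_congr fun x hxx => ?_
    rw [uIcc_of_le hεb] at hxx
    simp_rw [weight_slice_t, intervalIntegral.integral_const_mul]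
    have := integral_mul_deriv_mul_exp hT (g := fun t => v (x, t)) (g' := fun t => vt (x, t))
      (by fun_prop) (by fun_prop) (fun t htt => ht x hxx t htt) (lam * α) (-2 * lam * x)
    rw [this]
    ring
  have e3 : ∫ z in Om ε b T, (vx z - c z.1 * vt z) * v z * weight α lam z =
      (∫ z in Om ε b T, v z * vx z * weight α lam z) -
        ∫ z in Om ε b T, c z.1 * (v z * vt z * weight α lam z) := by
    rw [← integral_sub (I (by fun_prop)) (I (by fun_prop))]
    congr 1; ext z; ring
  -- Young's inequality in the form λ g v ≤ g² + (λ²/4) v², with g = vₓ - c vₜ.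
  have i1 : lam * (∫ z in Om ε b T, (vx z - c z.1 * vt z) * v z * weight α lam z) ≤
      (∫ z in Om ε b T, (vx z - c z.1 * vt z) ^ 2 * weight α lam z) +
        lam ^ 2 / 4 * ∫ z in Om ε b T, v z ^ 2 * weight α lam z := by
    rw [← integral_const_mul, ← integral_const_mul,
      ← integral_add (I (by fun_prop)) (I (by fun_prop))]
    refine integral_mono (I (by fun_prop)) (I (by fun_prop)) fun z => ?_
    have := mul_nonneg (sq_nonneg (vx z - c z.1 * vt z - lam / 2 * v z)) (weight_pos α lam z).le
    simp only
    linarith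
  have i2 : ∫ z in Om ε b T, lam * α * c z.1 * (v z ^ 2 * weight α lam z) ≤
      lam / 2 * ∫ z in Om ε b T, v z ^ 2 * weight α lam z := by
    rw [← integral_const_mul]
    refine integral_mono (I (by fun_prop)) (I (by fun_prop)) fun z => ?_
    refine mul_le_mul_of_nonneg_right ?_ (mul_nonneg (sq_nonneg _) (weight_pos α lam z).le)
    have h1 := mul_le_mul_of_nonneg_left (hcm z.1).2 hα.le
    have h2 := mul_le_mul_of_nonneg_left (h1.trans hαc) hlam.le
    linarith
  have i3 : ∫ x in ε..b, c x / 2 * (v (x, T) ^ 2 * weight α lam (x, T)) ≤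
      cm / 2 * ∫ x in ε..b, v (x, T) ^ 2 * weight α lam (x, T) := by
    rw [← intervalIntegral.integral_const_mul]
    refine intervalIntegral.integral_mono hεb ((by fun_prop : Continuous _).intervalIntegrable _ _)
      ((by fun_prop : Continuous _).intervalIntegrable _ _) fun x => ?_
    refine mul_le_mul_of_nonneg_right ?_ (mul_nonneg (sq_nonneg _) (weight_pos α lam _).le)
    linarith [(hcm x).2]
  have i4 : ∫ x in ε..b, v (x, 0) ^ 2 * weight α lam (x, 0) ≤
      ∫ x in ε..b, c x / 2 * (v (x, 0) ^ 2 * weight α lam (x, 0)) := by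
    refine intervalIntegral.integral_mono hεb ((by fun_prop : Continuous _).intervalIntegrable _ _)
      ((by fun_prop : Continuous _).intervalIntegrable _ _) fun x => ?_
    refine le_mul_of_one_le_left (mul_nonneg (sq_nonneg _) (weight_pos α lam _).le) ?_
    linarith [(hcm x).1]
  -- The coefficients of ∫v² combine to λ² - λ²/2 - λ²/4 = λ²/4; at t = 0 the factor c/2 ≥ 1 leaves
  -- λ∫v(x, 0)².
  rw [e3, e1, e2] at i1
  have j2 := mul_le_mul_of_nonneg_left i2 hlam.le
  have j3 := mul_le_mul_of_nonneg_left i3 hlam.le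
  have j4 := mul_le_mul_of_nonneg_left i4 hlam.le
  linarith

/-- The estimate of `p = hₜ` through `v = hₓ` and `vₓ - c vₜ`. -/
lemma carleman_time_derivative (hεb : ε ≤ b) (hT : 0 ≤ T) {v vx p vt : ℝ × ℝ → ℝ} {c : ℝ → ℝ}
    (hv : Continuous v) (hvx : Continuous vx) (hp : Continuous p) (hvt : Continuous vt)
    (hc : Continuous c)
    (hx : ∀ x ∈ Icc ε b, ∀ t ∈ Icc 0 T, v (x, t) = v (ε, t) + ∫ s in ε..x, vx (s, t))
    (hpx : ∀ x ∈ Icc ε b, ∀ t ∈ Icc 0 T, p (x, t) = p (ε, t) + ∫ s in ε..x, vt (s, t))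
    (hl : ∀ t ∈ Icc 0 T, v (ε, t) = 0) (hpl : ∀ t ∈ Icc 0 T, p (ε, t) = 0)
    (hc2 : ∀ x, 2 ≤ c x) {M : ℝ} (hM : 0 ≤ M)
    (hcl : ∀ x ∈ Icc ε b, ∀ y ∈ Icc ε b, |c x - c y| ≤ M * |x - y|) {α lam : ℝ} (hlam : 0 < lam)
    (hlamM : 2 * M ^ 2 ≤ lam ^ 2) :
    lam ^ 2 * (∫ z in Om ε b T, p z ^ 2 * weight α lam z) ≤
      2 * (∫ z in Om ε b T, (vx z - c z.1 * vt z) ^ 2 * weight α lam z) +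
        lam ^ 2 * ∫ z in Om ε b T, v z ^ 2 * weight α lam z := by
  have hw := continuous_weight α lam
  have I : ∀ {Φ : ℝ × ℝ → ℝ}, Continuous Φ →
      Integrable Φ ((volume : Measure (ℝ × ℝ)).restrict (Om ε b T)) :=
    fun h => continuous_integrable_muOm h
  -- Along each horizontal line v - c p vanishes at ε and has derivative (vₓ - c vₜ) - c' p, so the
  -- Hardy inequality applies to it.
  have i1 : lam ^ 2 * (∫ z in Om ε b T, (v z - c z.1 * p z) ^ 2 * weight α lam z) ≤
      2 * (∫ z in Om ε b T, (vx z - c z.1 * vt z) ^ 2 * weight α lam z) +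
        2 * M ^ 2 * ∫ z in Om ε b T, p z ^ 2 * weight α lam z := by
    rw [← integral_const_mul, ← integral_const_mul, ← integral_const_mul,
      ← integral_add (I (by fun_prop)) (I (by fun_prop))]
    refine integral_Om_mono_slices hεb hT (by fun_prop) (by fun_prop) fun t ht => ?_
    have := hardy_exp_sub_mul hεb (v := fun x => v (x, t)) (v' := fun x => vx (x, t))
      (p := fun x => p (x, t)) (p' := fun x => vt (x, t)) (c := c) (by fun_prop) (by fun_prop)
      (by fun_prop) (by fun_prop) hc (fun x hxx => hx x hxx t ht) (fun x hxx => hpx x hxx t ht)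
      (hl t ht) (hpl t ht) hM hcl hlam (-2 * lam * α * t)
    simp_rw [intervalIntegral.integral_const_mul, weight_slice_x]
    refine this.trans_eq ?_
    congr 1; ext x; ring
  have i2 : 2 * (∫ z in Om ε b T, p z ^ 2 * weight α lam z) ≤
      (∫ z in Om ε b T, (v z - c z.1 * p z) ^ 2 * weight α lam z) +
        ∫ z in Om ε b T, v z ^ 2 * weight α lam z := by
    rw [← integral_const_mul, ← integral_add (I (by fun_prop)) (I (by fun_prop))]
    refine integral_mono (I (by fun_prop)) (I (by fun_prop)) fun z => ?_
    have h1 : 4 ≤ c z.1 ^ 2 := by nlinarith [hc2 z.1]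
    have h2 := mul_le_mul_of_nonneg_right h1 (sq_nonneg (p z))
    -- The right side equals (2v - c p)²/2 + c²p²/2, and c² ≥ 4.
    have h3 : 2 * p z ^ 2 ≤ (v z - c z.1 * p z) ^ 2 + v z ^ 2 := by
      nlinarith [sq_nonneg (2 * v z - c z.1 * p z)]
    have h4 := mul_le_mul_of_nonneg_right h3 (weight_pos α lam z).le
    simp only
    linarith
  have hP : 0 ≤ ∫ z in Om ε b T, p z ^ 2 * weight α lam z :=
    integral_nonneg fun z => mul_nonneg (sq_nonneg _) (weight_pos α lam z).le
  -- Of 2λ²∫p², one half absorbs the error 2M²∫p², which is the purpose of 2M² ≤ λ².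
  have i3 := mul_le_mul_of_nonneg_left i2 (sq_nonneg lam)
  have i4 := mul_le_mul_of_nonneg_right hlamM hP
  linarith

/-- The Carleman estimate for `hₓₓ - c hₓₜ` with a classical function `h` that vanishes, with `hₓ`,
on `x = ε` and satisfies `hₓ = 0` on `x = b`. -/
lemma carleman_classical (hεb : ε < b) (hT : 0 < T) {u : H4 ε b T} {N : ℝ}
    {f fx ft fxx fxt : ℝ × ℝ → ℝ} (hr : ClassicalRep u N f fx ft fxx fxt)
    (hu : u ∈ H40 ε b T) {c : ℝ → ℝ} (hc : Continuous c) {cm : ℝ} (hcm : ∀ x, c x ∈ Icc 2 cm)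
    {M : ℝ} (hM : 0 ≤ M) (hcl : ∀ x ∈ Icc ε b, ∀ y ∈ Icc ε b, |c x - c y| ≤ M * |x - y|)
    {α lam : ℝ} (hα : 0 < α) (hαc : α * cm ≤ 1 / 2) (hlam : 1 ≤ lam)
    (hlamM : 2 * M ^ 2 ≤ lam ^ 2) :
    1 / 14 * (∫ z in Om ε b T, (lam * (fx z ^ 2 + ft z ^ 2) + lam ^ 3 * f z ^ 2) * weight α lam z) +
      1 / 14 * (∫ x in ε..b, (lam * fx (x, 0) ^ 2 + lam ^ 3 * f (x, 0) ^ 2) * weight α lam (x, 0)) ≤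
    (∫ z in Om ε b T, (fxx z - c z.1 * fxt z) ^ 2 * weight α lam z) +
      lam * cm / 2 * ∫ x in ε..b, fx (x, T) ^ 2 * weight α lam (x, T) := by
  have hw := continuous_weight α lam
  have hl0 : 0 < lam := by linarith
  have k1 := hr.cont_f
  have k2 := hr.cont_fx
  have k3 := hr.cont_ft
  have k4 := hr.cont_fxx
  have k5 := hr.cont_fxt
  have I : ∀ {Φ : ℝ × ℝ → ℝ}, Continuous Φ →
      Integrable Φ ((volume : Measure (ℝ × ℝ)).restrict (Om ε b T)) :=
    fun h => continuous_integrable_muOm h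
  have hlat : ∀ t ∈ Ioo 0 T, f (ε, t) = 0 ∧ fx (ε, t) = 0 ∧ fx (b, t) = 0 := by
    have h1 : u ∈ (H40 ε b T : Set (H4 ε b T)) := hu
    rw [H40_eq_lateralSet hεb hT] at h1
    exact (lateralSet_iff hεb hT hr.isContRep.1 hr.isContRep.2).1 h1
  have ext0 : ∀ {g : ℝ → ℝ}, Continuous g → (∀ t ∈ Ioo 0 T, g t = 0) → ∀ t ∈ Icc 0 T, g t = 0 := by
    intro g hg h
    have : EqOn g 0 (Ioo 0 T) := h
    have h2 := this.closure hg continuous_const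
    rwa [closure_Ioo hT.ne] at h2
  have z1 : ∀ t ∈ Icc 0 T, f (ε, t) = 0 :=
    ext0 (g := fun t => f (ε, t)) (by fun_prop) fun t ht => (hlat t ht).1
  have z2 : ∀ t ∈ Icc 0 T, fx (ε, t) = 0 :=
    ext0 (g := fun t => fx (ε, t)) (by fun_prop) fun t ht => (hlat t ht).2.1
  have z3 : ∀ t ∈ Icc 0 T, fx (b, t) = 0 :=
    ext0 (g := fun t => fx (b, t)) (by fun_prop) fun t ht => (hlat t ht).2.2
  have hεm : ε ∈ Icc ε b := left_mem_Icc.2 hεb.le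
  -- The trace f(ε, ·) vanishes identically, hence so does its derivative in t.
  have z4 : ∀ t ∈ Icc 0 T, ft (ε, t) = 0 := by
    refine ext0 (g := fun t => ft (ε, t)) (by fun_prop) fun t ht => ?_
    have d1 := hasDerivAt_of_eq_add_integral (g := fun t => f (ε, t)) (g' := fun t => ft (ε, t))
      (by fun_prop) (fun t ht => hr.f_t ε hεm t ht) ht
    have d2 : HasDerivAt (fun t => f (ε, t)) 0 t := by
      refine (hasDerivAt_const t (0 : ℝ)).congr_of_eventuallyEq ?_
      filter_upwards [Ioo_mem_nhds ht.1 ht.2] with s hs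
      exact z1 s (Ioo_subset_Icc_self hs)
    exact d1.unique d2
  have A1 := carleman_transport hεb.le hT.le k2 k4 k5 hc hr.fx_x hr.fx_t z2 z3 hcm hα hαc hl0
  have A2 := carleman_time_derivative (α := α) hεb.le hT.le k2 k4 k3 k5 hc hr.fx_x hr.ft_x z2 z4
    (fun x => (hcm x).1) hM hcl hl0 hlamM
  have A3 := hardy_Om (α := α) hεb.le hT.le k1 k2 hr.f_x z1 hl0
  have A4 : lam ^ 2 * ∫ x in ε..b, f (x, 0) ^ 2 * weight α lam (x, 0) ≤
      ∫ x in ε..b, fx (x, 0) ^ 2 * weight α lam (x, 0) := by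
    simp_rw [weight_slice_x]
    exact hardy_exp_of_eq_add_integral hεb.le (g := fun x => f (x, 0)) (g' := fun x => fx (x, 0))
      (by fun_prop) (by fun_prop) (fun x hx => hr.f_x x hx 0 (left_mem_Icc.2 hT.le))
      (z1 0 (left_mem_Icc.2 hT.le)) hl0 _
  have E1 : ∫ z in Om ε b T, (lam * (fx z ^ 2 + ft z ^ 2) + lam ^ 3 * f z ^ 2) * weight α lam z =
      lam * (∫ z in Om ε b T, fx z ^ 2 * weight α lam z) +
      lam * (∫ z in Om ε b T, ft z ^ 2 * weight α lam z) +
      lam ^ 3 * ∫ z in Om ε b T, f z ^ 2 * weight α lam z := by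
    rw [← integral_const_mul, ← integral_const_mul, ← integral_const_mul,
      ← integral_add (I (by fun_prop)) (I (by fun_prop)),
      ← integral_add (I (by fun_prop)) (I (by fun_prop))]
    congr 1; ext z; ring
  have E2 : ∫ x in ε..b, (lam * fx (x, 0) ^ 2 + lam ^ 3 * f (x, 0) ^ 2) * weight α lam (x, 0) =
      lam * (∫ x in ε..b, fx (x, 0) ^ 2 * weight α lam (x, 0)) +
      lam ^ 3 * ∫ x in ε..b, f (x, 0) ^ 2 * weight α lam (x, 0) := by
    rw [← intervalIntegral.integral_const_mul, ← intervalIntegral.integral_const_mul,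
      ← intervalIntegral.integral_add ((by fun_prop : Continuous _).intervalIntegrable _ _)
        ((by fun_prop : Continuous _).intervalIntegrable _ _)]
    congr 1; ext x; ring
  rw [E1, E2]
  have nn : ∀ g : ℝ × ℝ → ℝ, 0 ≤ ∫ z in Om ε b T, g z ^ 2 * weight α lam z := fun g =>
    integral_nonneg fun z => mul_nonneg (sq_nonneg _) (weight_pos α lam z).le
  have nV := nn fx
  have nP := nn ft
  have nV0 : 0 ≤ ∫ x in ε..b, fx (x, 0) ^ 2 * weight α lam (x, 0) :=
    intervalIntegral.integral_nonneg hεb.le fun x _ =>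
      mul_nonneg (sq_nonneg _) (weight_pos α lam _).le
  have nVT : 0 ≤ lam * cm / 2 * ∫ x in ε..b, fx (x, T) ^ 2 * weight α lam (x, T) := by
    refine mul_nonneg ?_ (intervalIntegral.integral_nonneg hεb.le fun x _ =>
      mul_nonneg (sq_nonneg _) (weight_pos α lam _).le)
    have : 0 ≤ cm := by linarith [(hcm 0).1, (hcm 0).2]
    positivity
  set V := ∫ z in Om ε b T, fx z ^ 2 * weight α lam z
  set P := ∫ z in Om ε b T, ft z ^ 2 * weight α lam z
  set H := ∫ z in Om ε b T, f z ^ 2 * weight α lam z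
  set V0 := ∫ x in ε..b, fx (x, 0) ^ 2 * weight α lam (x, 0)
  set H0 := ∫ x in ε..b, f (x, 0) ^ 2 * weight α lam (x, 0)
  -- With L the operator term and V, V0 the integrals of fx² in Ω and at t = 0, the five terms sum
  -- to at most 2L + 3λ²V + 2λV0. By the transport estimate A1 this is at most 2L + 12(L + top
  -- term), whence 14.
  have hl2 : lam ≤ lam ^ 2 := by nlinarith
  have B1 := mul_le_mul_of_nonneg_right hl2 nV
  have B2 := mul_le_mul_of_nonneg_right hl2 nP
  have B3 := mul_le_mul_of_nonneg_left A3 hl0.le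
  have B4 := mul_le_mul_of_nonneg_left A4 hl0.le
  have B5 := mul_nonneg hl0.le nV0
  have B6 : 0 ≤ lam ^ 2 * V := by positivity
  have c1 : lam ^ 3 * H = lam * (lam ^ 2 * H) := by ring
  have c2 : lam ^ 3 * H0 = lam * (lam ^ 2 * H0) := by ring
  linarith

end TwoDim

/-! ### Absorption of the trace at t = T by the penalty. -/

section Main

variable {ε b T : ℝ}

lemma trace_top_le (hε : 0 < ε) (hεb : ε < b) {u : H4 ε b T} {N : ℝ}
    {f fx ft fxx fxt : ℝ × ℝ → ℝ} (hr : ClassicalRep u N f fx ft fxx fxt) {α lam : ℝ}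
    (hlam : 0 < lam) : ∫ x in ε..b, fx (x, T) ^ 2 * weight α lam (x, T) ≤
      (b - ε) * N ^ 2 * Real.exp (-2 * lam * α * T) := by
  have hw := continuous_weight α lam
  have k2 := hr.cont_fx
  have h1 : ∫ x in ε..b, fx (x, T) ^ 2 * weight α lam (x, T) ≤
      ∫ _ in ε..b, N ^ 2 * Real.exp (-2 * lam * α * T) := by
    refine intervalIntegral.integral_mono_on hεb.le
      ((by fun_prop : Continuous _).intervalIntegrable _ _)
      (continuous_const.intervalIntegrable _ _) fun x hx => ?_
    refine mul_le_mul ?_ ?_ (weight_pos _ _ _).le (sq_nonneg _)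
    · have := hr.bound_fx (x, T)
      exact sq_le_sq' (abs_le.1 this).1 (abs_le.1 this).2
    · rw [weight_slice_x]
      apply Real.exp_le_exp.2
      have : 0 ≤ lam * x := mul_nonneg hlam.le (hε.le.trans hx.1)
      linarith
  rw [intervalIntegral.integral_const, smul_eq_mul] at h1
  linarith

/-- Since e^x ≥ x²/2 with x = λs, the assumption 2K ≤ λs² gives λK ≤ e^{λs}. -/
lemma mul_exp_neg_le_one {K s lam : ℝ} (hs : 0 < s) (hlam : 0 < lam)
    (h : 2 * K / s ^ 2 ≤ lam) : lam * K * Real.exp (-(lam * s)) ≤ 1 := by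
  have h1 := Real.quadratic_le_exp_of_nonneg (x := lam * s) (by positivity)
  rw [div_le_iff₀ (by positivity)] at h
  have h2 : lam * K ≤ Real.exp (lam * s) := by
    have h3 := mul_le_mul_of_nonneg_left h hlam.le
    have h4 : 0 < lam * s := by positivity
    nlinarith
  rw [Real.exp_neg, ← div_eq_mul_inv, div_le_one (Real.exp_pos _)]
  exact h2

/-- The Carleman estimate on `H⁴₀(Ω)`, with the term on `t = T` absorbed by the penalty. -/
lemma carleman_H40 (hε : 0 < ε) (hεb : ε < b) (hb : 1 < b) (hT : 0 < T) (R : ℝ) {α : ℝ}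
    (hα : 0 < α) (hαc : α * cMax b ≤ 1 / 2) : ∃ lam₁ : ℝ, 1 < lam₁ ∧
    ∀ lam, lam₁ ≤ lam → ∀ β : ℝ, 2 * Real.exp (-lam * α * T) ≤ β →
    ∀ (n : ℕ) (m : ℕ → H4 ε b T), (∀ k < n, ‖m k‖ ≤ R) → ∀ h ∈ H40 ε b T,
      1 / 14 * (∫ z in Om ε b T, (lam * (((h.D 1 0) z) ^ 2 + ((h.D 0 1) z) ^ 2)
          + lam ^ 3 * ((h.D 0 0) z) ^ 2) * weight α lam z)
        + 1 / 14 * (∫ x in ε..b, (lam * (contRep (h.D 1 0) (x, 0)) ^ 2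
          + lam ^ 3 * (contRep (h.D 0 0) (x, 0)) ^ 2) * Real.exp (-2 * lam * x)) ≤
      (∫ z in Om ε b T, opA m n h z ^ 2 * weight α lam z) + β / 2 * ‖h‖ ^ 2 := by
  obtain ⟨C, hC, hrep⟩ := exists_classicalRep hεb hT
  obtain ⟨M, hM, hlip⟩ := coefA_lipschitz hεb hb hT R
  have hcm := two_le_cMax hb
  have hαT : 0 < α * T := by positivity
  have hbε : 0 < b - ε := by linarith
  set K := cMax b / 2 * ((b - ε) * C ^ 2) with hK
  have hK0 : 0 ≤ K := by positivity
  -- The summands give, in turn, λ₁ > 1, 2M² ≤ λ², and λK e^{-λαT} ≤ 1. The choice precedes n and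
  -- the iterates, since M depends on them only through R.
  refine ⟨2 + 2 * M + 2 * K / (α * T) ^ 2, ?_, fun lam hlam β hβ n m hm h hh => ?_⟩
  · have : 0 ≤ 2 * K / (α * T) ^ 2 := by positivity
    linarith
  have hKd : 0 ≤ 2 * K / (α * T) ^ 2 := by positivity
  have hl1 : 1 ≤ lam := by linarith
  have hl0 : 0 < lam := by linarith
  have hlM : 2 * M ^ 2 ≤ lam ^ 2 := by nlinarith
  obtain ⟨f, fx, ft, fxx, fxt, hr⟩ := hrep h
  obtain ⟨c, hc, hcA, hcI⟩ := coefA_classical hεb hb hT m n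
  have key := carleman_classical hεb hT hr hh hc hcI hM.le (fun x hx y hy => by
    rw [← hcA x hx, ← hcA y hy]; exact hlip m n hm x hx y hy) hα hαc hl1 hlM
  have e1 : ∫ z in Om ε b T, (lam * (((h.D 1 0) z) ^ 2 + ((h.D 0 1) z) ^ 2)
      + lam ^ 3 * ((h.D 0 0) z) ^ 2) * weight α lam z =
      ∫ z in Om ε b T, (lam * (fx z ^ 2 + ft z ^ 2) + lam ^ 3 * f z ^ 2) * weight α lam z := by
    apply integral_congr_ae
    filter_upwards [hr.ae_f, hr.ae_fx, hr.ae_ft] with z h1 h2 h3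
    rw [h1, h2, h3]
  have e2 : ∫ x in ε..b, (lam * (contRep (h.D 1 0) (x, 0)) ^ 2
      + lam ^ 3 * (contRep (h.D 0 0) (x, 0)) ^ 2) * Real.exp (-2 * lam * x) =
      ∫ x in ε..b, (lam * fx (x, 0) ^ 2 + lam ^ 3 * f (x, 0) ^ 2) * weight α lam (x, 0) := by
    refine intervalIntegral.integral_congr fun x hx => ?_
    rw [uIcc_of_le hεb.le] at hx
    have hx' := mem_OmBar_bottom hT hx
    rw [hr.isContRep.1.contRep_eqOn hεb hT hx', hr.isContRep.2.contRep_eqOn hεb hT hx',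
      weight_slice_x, mul_zero, add_zero]
  have e3 : ∫ z in Om ε b T, opA m n h z ^ 2 * weight α lam z =
      ∫ z in Om ε b T, (fxx z - c z.1 * fxt z) ^ 2 * weight α lam z := by
    apply integral_congr_ae
    have hz := ae_mem_Om (ε := ε) (b := b) (T := T)
    filter_upwards [hr.ae_fxx, hr.ae_fxt, hz] with z h1 h2 h3
    rw [opA, h1, h2, hcA z.1 (Ioo_subset_Icc_self h3.1)]
  rw [e1, e2, e3]
  refine key.trans (add_le_add_right ?_ _)
  have t1 := mul_le_mul_of_nonneg_left (trace_top_le (α := α) hε hεb hr hl0)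
    (by positivity : 0 ≤ lam * cMax b / 2)
  refine t1.trans ?_
  have t2 := mul_exp_neg_le_one (K := K) hαT hl0 (by linarith)
  -- The factor e^{-2λαT} is split in two: one copy defeats λK, the other is at most β/2.
  have e4 : Real.exp (-2 * lam * α * T) =
      Real.exp (-(lam * (α * T))) * Real.exp (-lam * α * T) := by
    rw [← Real.exp_add]; congr 1; ring
  calc lam * cMax b / 2 * ((b - ε) * (C * ‖h‖) ^ 2 * Real.exp (-2 * lam * α * T))
      = (lam * K * Real.exp (-(lam * (α * T)))) * (Real.exp (-lam * α * T) * ‖h‖ ^ 2) := by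
        rw [e4, hK]; ring
    _ ≤ 1 * (Real.exp (-lam * α * T) * ‖h‖ ^ 2) :=
        mul_le_mul_of_nonneg_right t2 (by positivity)
    _ ≤ β / 2 * ‖h‖ ^ 2 := by
        rw [one_mul]
        exact mul_le_mul_of_nonneg_right (by linarith) (by positivity)

lemma IsIteration.norm_le {R : ℝ} {g₀ : ℝ → ℝ} {α lam β : ℝ} {n : ℕ} {m : ℕ → H4 ε b T}
    (hm : IsIteration R g₀ α lam β n m) : ∀ k < n, ‖m k‖ ≤ R := fun k hk =>
  norm_le_of_mem_closure_admB (hm k hk).1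

end Main

end Carleman1D

end


/-! ### Assembly of the four parts. -/

theorem theorem6p1 (ε b T R : ℝ) (hε : 0 < ε) (hε1 : ε < 1) (hb : 1 < b) (hT : 0 < T)
    (hR : 0 < R) :
    -- parts 1 and 2
    (∀ (α lam β : ℝ) (g₀ : ℝ → ℝ), 0 < α → α < 1 / 2 → (admB ε b T R g₀).Nonempty →
      ∀ (n : ℕ) (m : ℕ → H4 ε b T), IsIteration R g₀ α lam β n m →
        (∀ q ∈ closure (admB ε b T R g₀), ∃ g : H40 ε b T,
          IsFrechetDeriv (J α lam β m n) q g ∧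
          ∀ h : H40 ε b T, inner ℝ (g : H4 ε b T) (h : H4 ε b T) =
            2 * (∫ z in Om ε b T, (opA m n q z + termB m n z) * opA m n (h : H4 ε b T) z
              * weight α lam z) + 2 * β * inner ℝ q (h : H4 ε b T)) ∧
        (∃ D : ℝ, 0 < D ∧
          ∀ q₁ ∈ closure (admB ε b T R g₀), ∀ q₂ ∈ closure (admB ε b T R g₀),
          ∀ g₁ g₂ : H40 ε b T, IsFrechetDeriv (J α lam β m n) q₁ g₁ →
            IsFrechetDeriv (J α lam β m n) q₂ g₂ →
            ‖(g₂ : H4 ε b T) - (g₁ : H4 ε b T)‖ ≤ D * ‖q₂ - q₁‖)) ∧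
    -- parts 3 and 4
    (∃ α₀ : ℝ, 0 < α₀ ∧ α₀ ≤ 1 / 2 ∧ ∀ α : ℝ, 0 < α → α < α₀ →
      ∃ lam₁ C : ℝ, 1 < lam₁ ∧ 0 < C ∧
      ∀ g₀ : ℝ → ℝ, (admB ε b T R g₀).Nonempty →
      ∀ lam : ℝ, lam₁ ≤ lam → ∀ β : ℝ, 2 * Real.exp (-lam * α * T) ≤ β → β < 1 →
      ∀ (n : ℕ) (m : ℕ → H4 ε b T), IsIteration R g₀ α lam β n m →
        StrictConvexOn ℝ (closure (admB ε b T R g₀)) (J α lam β m n) ∧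
        (∀ q h : H4 ε b T, q ∈ closure (admB ε b T R g₀) → q + h ∈ closure (admB ε b T R g₀) →
          ∀ g : H40 ε b T, IsFrechetDeriv (J α lam β m n) q g →
            C * (∫ z in Om ε b T, (lam * (((h.D 1 0) z) ^ 2 + ((h.D 0 1) z) ^ 2)
                + lam ^ 3 * ((h.D 0 0) z) ^ 2) * weight α lam z)
              + C * (∫ x in ε..b, (lam * (contRep (h.D 1 0) (x, 0)) ^ 2
                + lam ^ 3 * (contRep (h.D 0 0) (x, 0)) ^ 2) * Real.exp (-2 * lam * x))
              + β / 2 * ‖h‖ ^ 2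
            ≤ J α lam β m n (q + h) - J α lam β m n q - inner ℝ (g : H4 ε b T) h) ∧
        (∃! p : H4 ε b T, IsMinimizer (J α lam β m n) (closure (admB ε b T R g₀)) p) ∧
        (∀ p : H4 ε b T, IsMinimizer (J α lam β m n) (closure (admB ε b T R g₀)) p →
          ∀ q ∈ closure (admB ε b T R g₀),
          ∀ g : H40 ε b T, IsFrechetDeriv (J α lam β m n) q g →
            0 ≤ inner ℝ (g : H4 ε b T) (q - p))) := by
  have hεb : ε < b := hε1.trans hb
  have := H40_complete (ε := ε) (b := b) hεb hT
  refine ⟨?_, ?_⟩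
  · intro α lam β g₀ _ _ _ n m _
    obtain ⟨A, B, hJ, hD, -⟩ := exists_J_eq_quadF hεb hb hT α lam β m n
    refine ⟨fun q _ => ?_, 2 * ‖A‖ ^ 2 + 2 * |β| + 1, by positivity, ?_⟩
    · obtain ⟨g, hg, hgq⟩ := quadF_exists_gradient A B β (H40 ε b T) q
      refine ⟨g, ?_, fun h => (hgq h).trans (hD q h)⟩
      rw [IsFrechetDeriv, hJ]
      exact hg
    · intro q₁ _ q₂ _ g₁ g₂ h₁ h₂
      rw [IsFrechetDeriv, hJ] at h₁ h₂
      exact quadF_gradient_lipschitz A B β (H40 ε b T) h₁ h₂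
  · have hcm := two_le_cMax hb
    -- This α₀ is exactly what makes α `cMax b` ≤ 1/2, so that the t-part of the transport estimate
    -- loses at most half of the x-part.
    refine ⟨1 / (2 * cMax b), by positivity, ?_, fun α hα hα0 => ?_⟩
    · exact one_div_le_one_div_of_le (by norm_num) (by linarith)
    have hαc : α * cMax b ≤ 1 / 2 := by
      rw [lt_div_iff₀ (by positivity)] at hα0
      linarith
    obtain ⟨lam₁, hlam₁, hcarl⟩ := carleman_H40 hε hεb hb hT R hα hαc
    refine ⟨lam₁, 1 / 14, hlam₁, by norm_num, fun g₀ hne lam hlam β hβ _ n m hm => ?_⟩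
    obtain ⟨A, B, hJ, -, hA⟩ := exists_J_eq_quadF hεb hb hT α lam β m n
    have hβ0 : 0 < β := lt_of_lt_of_le (by positivity) hβ
    have hK : Convex ℝ (closure (admB ε b T R g₀)) := convex_admB.closure
    have hgrad : ∀ {q : H4 ε b T} {g : H40 ε b T}, IsFrechetDeriv (J α lam β m n) q g →
        ∀ h ∈ H40 ε b T, inner ℝ (g : H4 ε b T) h = quadD A B β q h := by
      intro q g hg h hh
      rw [IsFrechetDeriv, hJ] at hg
      exact quadF_gradient_eq A B β (H40 ε b T) hg ⟨h, hh⟩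
    have hstrict : StrictConvexOn ℝ (closure (admB ε b T R g₀)) (J α lam β m n) := by
      rw [hJ]
      exact quadF_strictConvexOn A B β hK hβ0
    refine ⟨hstrict, fun q h hq hqh g hg => ?_, ?_, fun p hp q hq g hg => ?_⟩
    · have hh : h ∈ H40 ε b T := by simpa using sub_mem_H40 hεb hT hqh hq
      rw [hgrad hg h hh, hJ, quadF_add, hA]
      -- The Carleman estimate uses β/2 of the penalty in the exact expansion; the other β/2 is the
      -- last term of the claim.
      have := hcarl lam hlam β hβ n m hm.norm_le h hh
      linarith
    · obtain ⟨p, hp, hmin⟩ := quadF_exists_minimizer A B β hK isClosed_closure hne.closure hβ0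
      refine ⟨p, ⟨hp, by rw [hJ]; exact hmin⟩, fun p' hp' => ?_⟩
      refine hstrict.eq_of_isMinOn (fun q hq => hp'.2 q hq) (fun q hq => ?_) hp'.1 hp
      rw [hJ]
      exact hmin q hq
    · have hqp : p - q ∈ H40 ε b T := sub_mem_H40 hεb hT hp.1 hq
      have h1 := hp.2 q hq
      -- Expanding at q towards the minimizer gives J(p) = J(q) + [J'(q), p - q] + a nonnegative
      -- term; J(p) ≤ J(q) then fixes the sign.
      have h2 := quadF_add A B β q (p - q)
      rw [add_sub_cancel, ← hJ, ← hgrad hg _ hqp] at h2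
      have h3 : inner ℝ (g : H4 ε b T) (q - p) = -inner ℝ (g : H4 ε b T) (p - q) := by
        rw [← inner_neg_right, neg_sub]
      have h4 : 0 ≤ ‖A (p - q)‖ ^ 2 + β * ‖p - q‖ ^ 2 := by positivity
      linarith
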